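/- Let $0<\delta\le\frac32$ and $f_\delta(r)=r^\delta$ for $r>0$. The ODE $\dot z = i z f_\delta(|z|) - i$ on $\mathbb{C}\setminus\{0\}$ generates a topological flow $\Phi$ on $\mathbb{C}$ (a continuous one-parameter group of homeomorphisms of $\mathbb{C}$ whose trajectories solve the ODE whenever they are not at $0$). For a periodic point $z$ of $\Phi$ not on the orbit of $0$, let $T(z)=\inf\{t>0:\Phi(t,z)=z\}$ and define the net winding $$\omega_{f_\delta}(z)=\pm\frac1{2\pi}\int_0^{T(z)} f_\delta\bigl(|\Phi(t,z)|\bigr)\,dt ,$$ with the sign $+$ if the closed path $\Phi(\cdot,z)$ is oriented counter-clockwise and $-$ if it is oriented clockwise. Then every real $s$ with $0<s<1$ is a periodic point of $\Phi$ not on the orbit of $0$, and $$\tfrac12<\omega_{f_\delta}(s)<1 .$$ Consequently, the counter-clockwise oriented unit circle is the only Jordan solution of $\kappa=r^\delta$. Here a solution of $\kappa=r^\delta$ is a $C^\infty$ path $c:J\to\mathbb{C}$ parametrized by arc length on an open interval $J\ni 0$ (considered up to translation of the parameter) whose curvature, i.e. $\dot\vartheta$ for a smooth $\vartheta$ with $\dot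 c=e^{i\vartheta}$, equals $|c(t)|^\delta$ at all $t\in J$ with $c(t)\ne0$; it is maximal if $c(J)$ is not a proper subset of $\hat c(\hat J)$ for any solution $\hat c:\hat J\to\mathbb{C}$; and it is a Jordan solution if it is maximal and $c(J)$ is homeomorphic to the unit circle. Precisely: $t\mapsto e^{it}$, $t\in\mathbb{R}$, is a Jordan solution, and every Jordan solution $c:J\to\mathbb{C}$ satisfies $c(J)=\{z\in\mathbb{C}:|z|=1\}$ and, for some $a\in\mathbb{R}$, $c(t)=e^{i(t+a)}$ for all $t\in J$. -/

import Mathlib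

open Complex Set
open scoped ContDiff ComplexConjugate

noncomputable section

namespace CurvatureFlow

/-- The right-hand side of the ODE `ż = i z f(|z|) - i`. The function `f : (0,∞) → ℝ` is given as
a function on `ℝ` of which only the values at positive arguments are used. -/
def vectorField (f : ℝ → ℝ) (z : ℂ) : ℂ := I * z * (f ‖z‖ : ℂ) - I

/-- `Φ` is a topological flow on `ℂ` generated by the ODE `ż = i z f(|z|) - i` on `ℂ \ {0}`:
`Flow ℝ ℂ` is a jointly continuous one-parameter group of homeomorphisms of `ℂ`, and away from the
origin its trajectories solve the ODE. -/
def IsGeneratedBy (f : ℝ → ℝ) (Φ : Flow ℝ ℂ) : Prop :=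
  ∀ (z : ℂ) (t : ℝ), Φ t z ≠ 0 →
    HasDerivAt (fun u : ℝ => Φ u z) (vectorField f (Φ t z)) t

/-- The set `Per Φ` of periodic points (fixed points included). -/
def Per (Φ : Flow ℝ ℂ) : Set ℂ := {z | ∃ t : ℝ, 0 < t ∧ Φ t z = z}

/-- The minimal period `T(z) = inf {t > 0 : Φ(t,z) = z}` of a periodic point; it is `0` at fixed
points. (It is only used for points of `Per Φ`, where the infimum is over a nonempty set.) -/
def minPeriod (Φ : Flow ℝ ℂ) (z : ℂ) : ℝ := sInf {t : ℝ | 0 < t ∧ Φ t z = z}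

/-- The signed area `½ ∮ (x dy - y dx)` enclosed by the periodic orbit of `z`, traversed once. It is
positive if the closed path `Φ(·,z)` is oriented counter-clockwise and negative if it is oriented
clockwise. -/
def signedArea (Φ : Flow ℝ ℂ) (z : ℂ) : ℝ :=
  (1 / 2) * ∫ t in (0 : ℝ)..minPeriod Φ z, (conj (Φ t z) * deriv (fun u : ℝ => Φ u z) t).im

/-- The net winding `ω_f(z) = ± (1/2π) ∫₀^{T(z)} f(|Φ(t,z)|) dt` of a periodic point `z` whose orbit
avoids `0`, with the plus sign if the orbit is oriented counter-clockwise and the minus sign if it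
is oriented clockwise. (At a fixed point the integral is `0`, and so is the net winding.) -/
def netWinding (f : ℝ → ℝ) (Φ : Flow ℝ ℂ) (z : ℂ) : ℝ :=
  Real.sign (signedArea Φ z) *
    ((1 / (2 * Real.pi)) * ∫ t in (0 : ℝ)..minPeriod Φ z, f ‖Φ t z‖)

/-- `c` restricted to `J` is a smooth path parametrized by arc length, on an open interval `J`
containing `0`. Values of `c` outside `J` are irrelevant. An oriented smooth curve is the class of
such a path modulo translations of the parameter. -/
structure IsArcLengthPath (J : Set ℝ) (c : ℝ → ℂ) : Prop where
  isOpen : IsOpen J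
  ordConnected : J.OrdConnected
  zero_mem : (0 : ℝ) ∈ J
  smooth : ContDiffOn ℝ ∞ c J
  unit_speed : ∀ t ∈ J, ‖deriv c t‖ = 1

/-- `θ` is a smooth tangent angle of `c` on `J`, that is, `ċ = exp (i θ)`. It is unique up to an
additive constant in `2πℤ`, and the curvature of `c` is the derivative of `θ`. -/
structure IsTangentAngle (J : Set ℝ) (c : ℝ → ℂ) (θ : ℝ → ℝ) : Prop where
  smooth : ContDiffOn ℝ ∞ θ J
  deriv_eq : ∀ t ∈ J, deriv c t = Complex.exp (I * (θ t : ℂ))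

/-- The curve represented by `c : J → ℂ` is a solution of `κ = f(r)`: its curvature at `c t` is
`f |c t|` whenever `c t ≠ 0`. -/
def IsSolution (f : ℝ → ℝ) (J : Set ℝ) (c : ℝ → ℂ) : Prop :=
  IsArcLengthPath J c ∧
    ∃ θ : ℝ → ℝ, IsTangentAngle J c θ ∧ ∀ t ∈ J, c t ≠ 0 → deriv θ t = f ‖c t‖

/-- A solution is maximal if the set of points it traces is not properly contained in the set traced
by another solution. -/
def IsMaximalSolution (f : ℝ → ℝ) (J : Set ℝ) (c : ℝ → ℂ) : Prop :=
  IsSolution f J c ∧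
    ∀ (J' : Set ℝ) (c' : ℝ → ℂ), IsSolution f J' c' → c '' J ⊆ c' '' J' → c '' J = c' '' J'

/-- A Jordan solution is a maximal solution that is simple closed, that is, the set of points it
traces is homeomorphic to the unit circle. -/
def IsJordanSolution (f : ℝ → ℝ) (J : Set ℝ) (c : ℝ → ℂ) : Prop :=
  IsMaximalSolution f J c ∧ Nonempty ((c '' J : Set ℂ) ≃ₜ Circle)

end CurvatureFlow

end

/-!
Write `z = x + i y` and `r = |z|`. The ODE `ż = i z r^δ - i` has the first integral
`H(z) = r^(δ+2)/(δ+2) - x` with compact levels and the single minimum `z = 1`, and its right-hand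
side is locally Lipschitz, also at the origin; hence the flow exists (`exists_flow_isGeneratedBy`).
Complex conjugation reverses time. So a solution `Z` with `Z 0 = p < 1` real, `p ≠ 0`, is periodic
and symmetric as soon as it meets the real axis again, at a time `τ` and a point `q`; then `2 τ` is
the period.

If `θ` is the integral of `r^δ` along `Z`, the curve `c = conj Z · exp (i θ)` (`develop`) has speed
`1`, tangent `i exp (i θ)` and curvature `r^δ` at distance `r` from the origin. All estimates come
from this curve. Put `Ψ = θ(τ)`; the net winding of `p ∈ (0, 1)` is `Ψ / π`.

* `Ψ < π`, and `τ` exists. As long as `r` increases, `r^δ Im c + Re ċ` has the derivative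
  `(r^δ)˙ Im c`, which excludes a return of `c` to the real axis before `θ` reaches `π`
  (`IsFrame.angle_lt_pi`).
* `Ψ > π / 2` if `0 < p < 1`. The evolute `c - r^(-δ) exp (i θ)` has velocity `-(r^(-δ))˙ exp (i θ)`,
  so the length of its arc over half a period is `p^(-δ) - q^(-δ)`. The ends of the arc are at the
  distances `p^(-δ) - p` and `q - q^(-δ)` from the origin, in directions enclosing the angle `π - Ψ`,
  and `(p^(-δ) - q^(-δ))² < (p^(-δ) - p)² + (q - q^(-δ))²` for `δ ≤ 3/2` (`sq_rpow_sub_lt`). Hence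
  `cos Ψ < 0` (`IsFrame.cos_angle_neg`).

Conversely, along a solution `c` of `κ = r^δ` the moving coordinate `-i conj(c) ċ` solves the ODE;
`c` avoids the origin because `|t|^δ` is not smooth (`IsSolution.ne_zero`). A Jordan solution has
points nearest to and farthest from the origin, where the moving coordinate is real. If one of these
values is `p < 1`, then by maximality the curve is, up to a rotation, the complete curve `develop`
of the solution through `p`. It is symmetric with respect to the axis through its point at time `τ`,
and the bounds on `Ψ` force it to cross this axis at a point which is not an extremum of `r`. In a
set homeomorphic to a circle the curve then coincides with its mirror image near the crossing
(`eventually_mem_arc`), so it runs in the axis, contrary to its positive curvature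
(`IsFrame.not_nonempty_homeomorph_circle`). Otherwise both values are at least `1`; as they lie on
one level of `H` they agree, the distance from the origin is constant, and the curve is the unit
circle. The unit circle is maximal since any other solution has modulus `1` at countably many times
only (`countable_norm_eq_one`).
-/

namespace CurvatureFlow

/-! ### The first integral and the Lipschitz estimate -/

/-- The first integral `H(z) = |z|^(δ+2)/(δ+2) - Re z` of the ODE `ż = i z |z|^δ - i`. -/
noncomputable def firstIntegral (δ : ℝ) (z : ℂ) : ℝ := ‖z‖ ^ (δ + 2) / (δ + 2) - z.re

theorem vectorField_re (f : ℝ → ℝ) (z : ℂ) : (vectorField f z).re = -z.im * f ‖z‖ := by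
  simp [vectorField]

theorem vectorField_im (f : ℝ → ℝ) (z : ℂ) : (vectorField f z).im = z.re * f ‖z‖ - 1 := by
  simp [vectorField]

theorem vectorField_conj (f : ℝ → ℝ) (z : ℂ) :
    vectorField f (conj z) = -conj (vectorField f z) := by
  apply Complex.ext
  · simp [vectorField]
  · simp [vectorField]
    ring

theorem hasDerivAt_re_of_hasDerivAt {Z : ℝ → ℂ} {v : ℂ} {t : ℝ} (h : HasDerivAt Z v t) :
    HasDerivAt (fun u => (Z u).re) v.re t :=
  (Complex.reCLM.hasFDerivAt.comp_hasDerivAt t h :)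

theorem hasDerivAt_im_of_hasDerivAt {Z : ℝ → ℂ} {v : ℂ} {t : ℝ} (h : HasDerivAt Z v t) :
    HasDerivAt (fun u => (Z u).im) v.im t :=
  (Complex.imCLM.hasFDerivAt.comp_hasDerivAt t h :)

theorem hasDerivAt_conj_of_hasDerivAt {Z : ℝ → ℂ} {v : ℂ} {t : ℝ} (h : HasDerivAt Z v t) :
    HasDerivAt (fun u => conj (Z u)) (conj v) t :=
  (Complex.conjCLE.toContinuousLinearMap.hasFDerivAt.comp_hasDerivAt t h :)

theorem hasDerivAt_norm_sq_of_vectorField {f : ℝ → ℝ} {Z : ℝ → ℂ} {t : ℝ}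
    (h : HasDerivAt Z (vectorField f (Z t)) t) :
    HasDerivAt (fun u => ‖Z u‖ ^ 2) (-2 * (Z t).im) t := by
  have h1 := (hasDerivAt_re_of_hasDerivAt h).pow 2
  have h2 := (hasDerivAt_im_of_hasDerivAt h).pow 2
  have h3 := h1.add h2
  rw [vectorField_re, vectorField_im] at h3
  have e : (fun u => ‖Z u‖ ^ 2) = fun u => (Z u).re ^ 2 + (Z u).im ^ 2 := by
    funext u
    rw [← Complex.normSq_eq_norm_sq, Complex.normSq_apply]; ring
  rw [e]
  refine h3.congr_deriv ?_
  push_cast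
  ring

theorem norm_rpow_eq_sq_rpow (z : ℂ) (a : ℝ) : ‖z‖ ^ a = (‖z‖ ^ 2) ^ (a / 2) := by
  rw [← Real.rpow_natCast, ← Real.rpow_mul (norm_nonneg z)]
  congr 1
  push_cast
  ring

theorem hasDerivAt_norm_rpow {f : ℝ → ℝ} {Z : ℝ → ℂ} {t : ℝ} (a : ℝ)
    (h : HasDerivAt Z (vectorField f (Z t)) t) (hz : Z t ≠ 0 ∨ 2 ≤ a) :
    HasDerivAt (fun u => ‖Z u‖ ^ a) (-a * (Z t).im * ‖Z t‖ ^ (a - 2)) t := by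
  have e : (fun u => ‖Z u‖ ^ a) = fun u => (‖Z u‖ ^ 2) ^ (a / 2) := by
    funext u; exact norm_rpow_eq_sq_rpow _ _
  rw [e, norm_rpow_eq_sq_rpow (Z t) (a - 2)]
  have h1 := (hasDerivAt_norm_sq_of_vectorField h).rpow_const (p := a / 2) (by
    rcases hz with hz | hz
    · left; positivity
    · right; linarith)
  convert h1 using 1
  have : (a - 2) / 2 = a / 2 - 1 := by ring
  rw [this]; ring

theorem hasDerivAt_firstIntegral {δ : ℝ} (hδ : 0 < δ) {Z : ℝ → ℂ} {t : ℝ}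
    (h : HasDerivAt Z (vectorField (fun r => r ^ δ) (Z t)) t) :
    HasDerivAt (fun u => firstIntegral δ (Z u)) 0 t := by
  have h1 := hasDerivAt_norm_rpow (δ + 2) h (Or.inr (by linarith))
  have h2 := (h1.div_const (δ + 2)).sub (hasDerivAt_re_of_hasDerivAt h)
  rw [vectorField_re] at h2
  refine h2.congr_deriv ?_
  have : δ + 2 ≠ 0 := by positivity
  have e : δ + 2 - 2 = δ := by ring
  rw [e]; field_simp; ring

theorem continuous_firstIntegral {δ : ℝ} (hδ : 0 < δ) : Continuous (firstIntegral δ) := by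
  unfold firstIntegral
  have : Continuous fun z : ℂ => ‖z‖ ^ (δ + 2) :=
    continuous_norm.rpow_const (fun _ => Or.inr (by linarith))
  fun_prop

/-- A continuous path which solves the ODE near each of its points on the level of the initial
point stays on that level: the set of times at which it is on the level is open and closed. -/
theorem firstIntegral_eq_of_eventually {δ : ℝ} (hδ : 0 < δ) {Z : ℝ → ℂ} (hZ : Continuous Z)
    {t₀ : ℝ}
    (h : ∀ t, firstIntegral δ (Z t) = firstIntegral δ (Z t₀) → ∀ᶠ u in nhds t,
      HasDerivAt Z (vectorField (fun r => r ^ δ) (Z u)) u) (t : ℝ) :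
    firstIntegral δ (Z t) = firstIntegral δ (Z t₀) := by
  have hc : Continuous fun u => firstIntegral δ (Z u) := (continuous_firstIntegral hδ).comp hZ
  have hclosed : IsClosed {u | firstIntegral δ (Z u) = firstIntegral δ (Z t₀)} :=
    isClosed_eq hc continuous_const
  have hopen : IsOpen {u | firstIntegral δ (Z u) = firstIntegral δ (Z t₀)} := by
    rw [Metric.isOpen_iff]
    intro s hs
    obtain ⟨ε, hε, hball⟩ := Metric.eventually_nhds_iff_ball.1 (h s hs)
    refine ⟨ε, hε, fun u hu => ?_⟩
    have := (convex_ball s ε).is_const_of_fderivWithin_eq_zero (𝕜 := ℝ)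
      (f := fun u => firstIntegral δ (Z u))
      (fun x hx => (hasDerivAt_firstIntegral hδ (hball x hx)).differentiableAt.differentiableWithinAt)
      (fun x hx => by
        rw [fderivWithin_of_isOpen Metric.isOpen_ball hx]
        simpa using (hasDerivAt_firstIntegral hδ (hball x hx)).hasFDerivAt.fderiv)
      hu (Metric.mem_ball_self hε)
    exact this.trans hs
  have := IsClopen.eq_univ ⟨hclosed, hopen⟩ ⟨t₀, rfl⟩
  exact (this ▸ mem_univ t : t ∈ {u | firstIntegral δ (Z u) = firstIntegral δ (Z t₀)})

/-- The graph of `x ↦ x^(1+δ)` lies above its tangents. -/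
theorem rpow_tangent_le {δ a b : ℝ} (hδ : 0 < δ) (ha : 0 ≤ a) (hb : 0 ≤ b) :
    a ^ (1 + δ) + (1 + δ) * a ^ δ * (b - a) ≤ b ^ (1 + δ) := by
  rcases ha.eq_or_lt with rfl | ha
  · rw [Real.zero_rpow (by linarith), Real.zero_rpow hδ.ne']
    have := Real.rpow_nonneg hb (1 + δ)
    linarith
  · have h := one_add_mul_self_le_rpow_one_add (s := b / a - 1) (p := 1 + δ)
      (by have : 0 ≤ b / a := by positivity
          linarith) (by linarith)
    have e : 1 + (b / a - 1) = b / a := by ring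
    rw [e, Real.div_rpow hb ha.le, le_div_iff₀ (by positivity), Real.rpow_add ha,
      Real.rpow_one] at h
    rw [Real.rpow_add ha, Real.rpow_one]
    refine le_trans (le_of_eq ?_) h
    field_simp

theorem norm_mul_rpow_sub_le {δ R : ℝ} (hδ : 0 < δ) {z w : ℂ} (hz : ‖z‖ ≤ R) (hwz : ‖w‖ ≤ ‖z‖) :
    ‖z * ((‖z‖ ^ δ : ℝ) : ℂ) - w * ((‖w‖ ^ δ : ℝ) : ℂ)‖ ≤ (1 + δ) * R ^ δ * ‖z - w‖ := by
  have e : z * ((‖z‖ ^ δ : ℝ) : ℂ) - w * ((‖w‖ ^ δ : ℝ) : ℂ) =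
      (z - w) * ((‖z‖ ^ δ : ℝ) : ℂ) + w * ((‖z‖ ^ δ - ‖w‖ ^ δ : ℝ) : ℂ) := by
    push_cast; ring
  have h1 : 0 ≤ ‖z‖ ^ δ - ‖w‖ ^ δ :=
    sub_nonneg.2 (Real.rpow_le_rpow (norm_nonneg _) hwz hδ.le)
  have h2 := rpow_tangent_le hδ (norm_nonneg z) (norm_nonneg w)
  have h0 : 0 ≤ ‖z‖ ^ δ := Real.rpow_nonneg (norm_nonneg _) _
  rw [Real.rpow_add' (norm_nonneg _) (by linarith), Real.rpow_add' (norm_nonneg _) (by linarith),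
    Real.rpow_one, Real.rpow_one] at h2
  have h3 : ‖w‖ * (‖z‖ ^ δ - ‖w‖ ^ δ) ≤ δ * ‖z‖ ^ δ * (‖z‖ - ‖w‖) := by nlinarith
  have h4 : ‖z‖ - ‖w‖ ≤ ‖z - w‖ := norm_sub_norm_le z w
  rw [e]
  calc _ ≤ ‖z - w‖ * ‖z‖ ^ δ + ‖w‖ * (‖z‖ ^ δ - ‖w‖ ^ δ) := by
        refine (norm_add_le _ _).trans (le_of_eq ?_)
        rw [norm_mul, norm_mul, Complex.norm_of_nonneg h1, Complex.norm_of_nonneg h0]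
    _ ≤ ‖z - w‖ * ‖z‖ ^ δ + δ * ‖z‖ ^ δ * ‖z - w‖ := by
        have : δ * ‖z‖ ^ δ * (‖z‖ - ‖w‖) ≤ δ * ‖z‖ ^ δ * ‖z - w‖ := by gcongr
        linarith
    _ = (1 + δ) * ‖z‖ ^ δ * ‖z - w‖ := by ring
    _ ≤ (1 + δ) * R ^ δ * ‖z - w‖ := by gcongr

theorem lipschitzOnWith_vectorField {δ R : ℝ} (hδ : 0 < δ) :
    LipschitzOnWith (Real.toNNReal ((1 + δ) * R ^ δ)) (vectorField (fun r => r ^ δ))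
      (Metric.closedBall 0 R) := by
  refine LipschitzOnWith.of_dist_le' fun z hz w hw => ?_
  rw [mem_closedBall_zero_iff] at hz hw
  rw [dist_eq_norm, dist_eq_norm]
  have e : vectorField (fun r => r ^ δ) z - vectorField (fun r => r ^ δ) w =
      I * (z * ((‖z‖ ^ δ : ℝ) : ℂ) - w * ((‖w‖ ^ δ : ℝ) : ℂ)) := by
    simp only [vectorField]; ring
  rw [e, norm_mul, norm_I, one_mul]
  rcases le_total ‖w‖ ‖z‖ with h | h
  · exact norm_mul_rpow_sub_le hδ hz h
  · rw [norm_sub_rev, norm_sub_rev z w]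
    exact norm_mul_rpow_sub_le hδ hw h

theorem exists_norm_le_of_firstIntegral_le {δ : ℝ} (hδ : 0 < δ) (E : ℝ) :
    ∃ R : ℝ, 0 < R ∧ ∀ z : ℂ, firstIntegral δ z ≤ E → ‖z‖ ≤ R := by
  -- The tangent of `r ↦ r^(δ+2)` at `2` has a slope exceeding `δ + 2`.
  have h2 : (2 : ℝ) < 2 ^ (1 + δ) := by
    conv_lhs => rw [← Real.rpow_one 2]
    exact Real.rpow_lt_rpow_of_exponent_lt (by norm_num) (by linarith)
  refine ⟨|E| + 4, by positivity, fun z hz => ?_⟩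
  have h := rpow_tangent_le (δ := 1 + δ) (a := 2) (by linarith) (by norm_num) (norm_nonneg z)
  have e : (1 : ℝ) + (1 + δ) = δ + 2 := by ring
  rw [e] at h
  unfold firstIntegral at hz
  have hre := Complex.re_le_norm z
  have hE := le_abs_self E
  have h4 : 0 ≤ (2 : ℝ) ^ (δ + 2) := by positivity
  have h5 : 2 ^ (1 + δ) * (‖z‖ - 2) ≤ ‖z‖ ^ (δ + 2) / (δ + 2) := by
    rw [le_div_iff₀ (by linarith)]; linarith
  by_contra! hc
  have hE0 := abs_nonneg E
  nlinarith

theorem eq_one_of_firstIntegral_eq {δ : ℝ} (hδ : 0 < δ) {z : ℂ}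
    (hz : firstIntegral δ z = firstIntegral δ 1) : z = 1 := by
  have e : (1 : ℝ) + (1 + δ) = δ + 2 := by ring
  unfold firstIntegral at hz
  have hre := Complex.re_le_norm z
  simp only [norm_one, Real.one_rpow, one_re] at hz
  have hn : ‖z‖ = 1 := by
    by_contra hne
    have h := one_add_mul_self_lt_rpow_one_add (s := ‖z‖ - 1) (p := δ + 2)
      (by linarith [norm_nonneg z]) (sub_ne_zero.2 hne) (by linarith)
    rw [add_sub_cancel] at h
    have h1 : ‖z‖ ^ (δ + 2) / (δ + 2) > 1 / (δ + 2) + (‖z‖ - 1) := by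
      rw [gt_iff_lt, div_add' _ _ _ (by linarith)]
      gcongr
      linarith
    linarith
  rw [hn, Real.one_rpow] at hz
  have h1 : z.re = 1 := by linarith
  have h2 := Complex.normSq_eq_norm_sq z
  rw [Complex.normSq_apply, hn, h1] at h2
  apply Complex.ext
  · simpa using h1
  · simp
    nlinarith

/-! ### Uniqueness and symmetry of solutions -/

/-- `Z` is a solution of `ż = i z |z|^δ - i` for all times. -/
def IsGlobalSolution (δ : ℝ) (Z : ℝ → ℂ) : Prop :=
  ∀ t, HasDerivAt Z (vectorField (fun r => r ^ δ) (Z t)) t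

namespace IsGlobalSolution

variable {δ : ℝ} {Z W : ℝ → ℂ}

theorem continuous (h : IsGlobalSolution δ Z) : Continuous Z :=
  continuous_iff_continuousAt.2 fun t => (h t).continuousAt

theorem firstIntegral_eq (hδ : 0 < δ) (h : IsGlobalSolution δ Z) (s t : ℝ) :
    firstIntegral δ (Z s) = firstIntegral δ (Z t) :=
  firstIntegral_eq_of_eventually hδ h.continuous (fun _ _ => Filter.Eventually.of_forall h) s

theorem comp_add_const (h : IsGlobalSolution δ Z) (a : ℝ) :
    IsGlobalSolution δ fun t => Z (t + a) :=
  fun t => (h (t + a)).comp_add_const t a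

/-- Solutions are reversed by complex conjugation. -/
theorem conj_comp_sub (h : IsGlobalSolution δ Z) (a : ℝ) :
    IsGlobalSolution δ fun t => conj (Z (a - t)) := by
  intro t
  rw [vectorField_conj]
  have h1 := (h (a - t)).comp_const_sub a t
  simpa using hasDerivAt_conj_of_hasDerivAt h1

theorem dist_le (hδ : 0 < δ) {R : ℝ} (hZ : IsGlobalSolution δ Z) (hW : IsGlobalSolution δ W)
    (hZR : ∀ t, ‖Z t‖ ≤ R) (hWR : ∀ t, ‖W t‖ ≤ R) (t : ℝ) :
    dist (Z t) (W t) ≤ dist (Z 0) (W 0) * Real.exp (Real.toNNReal ((1 + δ) * R ^ δ) * |t|) := by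
  have key : ∀ {Z W : ℝ → ℂ}, IsGlobalSolution δ Z → IsGlobalSolution δ W →
      (∀ t, ‖Z t‖ ≤ R) → (∀ t, ‖W t‖ ≤ R) → ∀ t, 0 ≤ t → dist (Z t) (W t) ≤
        dist (Z 0) (W 0) * Real.exp (Real.toNNReal ((1 + δ) * R ^ δ) * t) := by
    intro Z W hZ hW hZR hWR t ht
    have := dist_le_of_trajectories_ODE_of_mem (v := fun _ => vectorField fun r => r ^ δ)
      (s := fun _ => Metric.closedBall 0 R) (a := 0) (b := t) (f := Z) (g := W)
      (fun _ _ => lipschitzOnWith_vectorField hδ)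
      hZ.continuous.continuousOn (fun u _ => (hZ u).hasDerivWithinAt) (fun u _ => by simpa using hZR u)
      hW.continuous.continuousOn (fun u _ => (hW u).hasDerivWithinAt) (fun u _ => by simpa using hWR u)
      le_rfl t ⟨ht, le_rfl⟩
    simpa using this
  rcases le_total 0 t with ht | ht
  · rw [abs_of_nonneg ht]
    exact key hZ hW hZR hWR t ht
  · rw [abs_of_nonpos ht]
    have := key (hZ.conj_comp_sub 0) (hW.conj_comp_sub 0) (fun t => by simpa using hZR _)
      (fun t => by simpa using hWR _) (-t) (by linarith)
    simpa [Complex.dist_conj_conj] using this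

end IsGlobalSolution

/-- Two solutions on an open interval which agree at one time are equal there. -/
theorem eqOn_of_hasDerivAt {δ : ℝ} (hδ : 0 < δ) {J : Set ℝ} (hJ : IsOpen J)
    (hJ' : J.OrdConnected) {Z W : ℝ → ℂ}
    (hZ : ∀ t ∈ J, HasDerivAt Z (vectorField (fun r => r ^ δ) (Z t)) t)
    (hW : ∀ t ∈ J, HasDerivAt W (vectorField (fun r => r ^ δ) (W t)) t) {t₀ : ℝ} (ht₀ : t₀ ∈ J)
    (h : Z t₀ = W t₀) : EqOn Z W J := by
  intro t ht
  obtain ⟨a, b, hlt, hsub⟩ : ∃ a b, t₀ ∈ Ioo a b ∧ t ∈ Ioo a b ∧ Icc a b ⊆ J := by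
    have hmin : min t₀ t ∈ J := by rcases min_choice t₀ t with h | h <;> rw [h] <;> assumption
    have hmax : max t₀ t ∈ J := by rcases max_choice t₀ t with h | h <;> rw [h] <;> assumption
    obtain ⟨ε, hε, h1⟩ := Metric.isOpen_iff.1 hJ _ hmin
    obtain ⟨η, hη, h2⟩ := Metric.isOpen_iff.1 hJ _ hmax
    refine ⟨min t₀ t - ε / 2, max t₀ t + η / 2, ⟨?_, ?_⟩, ⟨?_, ?_⟩, hJ'.out (h1 ?_) (h2 ?_)⟩
    · linarith [min_le_left t₀ t]
    · linarith [le_max_left t₀ t]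
    · linarith [min_le_right t₀ t]
    · linarith [le_max_right t₀ t]
    · simp [abs_of_pos hε]; linarith
    · simp [abs_of_pos hη]; linarith
  obtain ⟨htab, hsub⟩ := hsub
  have hcZ : ContinuousOn Z (Icc a b) := fun u hu => (hZ u (hsub hu)).continuousAt.continuousWithinAt
  have hcW : ContinuousOn W (Icc a b) := fun u hu => (hW u (hsub hu)).continuousAt.continuousWithinAt
  obtain ⟨R₁, hR₁⟩ := isCompact_Icc.exists_bound_of_continuousOn hcZ
  obtain ⟨R₂, hR₂⟩ := isCompact_Icc.exists_bound_of_continuousOn hcW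
  have hmem : ∀ u ∈ Ioo a b, u ∈ Icc a b := fun u hu => Ioo_subset_Icc_self hu
  exact ODE_solution_unique_of_mem_Ioo (v := fun _ => vectorField fun r => r ^ δ)
    (s := fun _ => Metric.closedBall 0 (max R₁ R₂))
    (fun _ _ => lipschitzOnWith_vectorField hδ) hlt
    (fun u hu => ⟨hZ u (hsub (hmem u hu)), by
      simpa using Or.inl (hR₁ u (hmem u hu))⟩)
    (fun u hu => ⟨hW u (hsub (hmem u hu)), by
      simpa using Or.inr (hR₂ u (hmem u hu))⟩) h htab

theorem IsGlobalSolution.unique {δ : ℝ} {Z W : ℝ → ℂ} (hδ : 0 < δ) (hZ : IsGlobalSolution δ Z)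
    (hW : IsGlobalSolution δ W) {t₀ : ℝ} (h : Z t₀ = W t₀) (t : ℝ) : Z t = W t :=
  eqOn_of_hasDerivAt hδ isOpen_univ ordConnected_univ (fun t _ => hZ t) (fun t _ => hW t)
    (mem_univ t₀) h (mem_univ t)

/-! ### Existence of the flow -/

/-- A bounded, globally Lipschitz vector field on a Banach space has a solution for all times
through each point. -/
theorem exists_forall_hasDerivAt_of_bounded {E : Type*} [NormedAddCommGroup E] [NormedSpace ℝ E]
    [CompleteSpace E] {v : E → E} {K L : NNReal} (hv : LipschitzWith K v) (hL : ∀ x, ‖v x‖ ≤ L)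
    (x₀ : E) : ∃ α : ℝ → E, α 0 = x₀ ∧ ∀ t, HasDerivAt α (v (α t)) t := by
  have hex : ∀ n : ℕ, ∃ α : ℝ → E, α 0 = x₀ ∧
      ∀ t ∈ Ioo (-(n + 1 : ℝ)) (n + 1), HasDerivAt α (v (α t)) t := by
    intro n
    have h0 : (0 : ℝ) ∈ Icc (-(n + 1 : ℝ)) (n + 1) := ⟨by linarith [n.cast_nonneg (α := ℝ)],
      by positivity⟩
    have hP : IsPicardLindelof (fun _ => v) (⟨0, h0⟩ : Icc (-(n + 1 : ℝ)) (n + 1)) x₀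
        (L * (n + 1)) 0 L K :=
      IsPicardLindelof.of_time_independent (fun x _ => hL x) hv.lipschitzOnWith (by simp)
    obtain ⟨α, h1, h2⟩ := hP.exists_eq_forall_mem_Icc_hasDerivWithinAt₀
    exact ⟨α, h1, fun t ht => (h2 t (Ioo_subset_Icc_self ht)).hasDerivAt (Icc_mem_nhds ht.1 ht.2)⟩
  choose α hα0 hα using hex
  have hagree : ∀ (n m : ℕ) (t : ℝ), |t| < n + 1 → |t| < m + 1 → α n t = α m t := by
    intro n m t hn hm
    have h0 : (0 : ℝ) < min (n + 1 : ℝ) (m + 1) := by positivity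
    refine ODE_solution_unique_of_mem_Ioo (v := fun _ => v) (s := fun _ => univ)
      (a := -min (n + 1 : ℝ) (m + 1)) (b := min (n + 1 : ℝ) (m + 1)) (t₀ := 0)
      (fun _ _ => hv.lipschitzOnWith) ⟨by linarith, h0⟩
      (fun u hu => ⟨hα n u ⟨?_, ?_⟩, mem_univ _⟩) (fun u hu => ⟨hα m u ⟨?_, ?_⟩, mem_univ _⟩)
      (by rw [hα0, hα0]) (abs_lt.1 (lt_min hn hm))
    · linarith [hu.1, min_le_left (n + 1 : ℝ) (m + 1)]
    · linarith [hu.2, min_le_left (n + 1 : ℝ) (m + 1)]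
    · linarith [hu.1, min_le_right (n + 1 : ℝ) (m + 1)]
    · linarith [hu.2, min_le_right (n + 1 : ℝ) (m + 1)]
  refine ⟨fun t => α ⌈|t|⌉₊ t, hα0 _, fun t => ?_⟩
  have hlt : ∀ u : ℝ, |u| < (⌈|u|⌉₊ : ℝ) + 1 := fun u => by linarith [Nat.le_ceil |u|]
  have hev : (fun u => α ⌈|u|⌉₊ u) =ᶠ[nhds t] α ⌈|t|⌉₊ := by
    filter_upwards [(continuous_abs.tendsto t).eventually_lt_const (hlt t)] with u hu
    exact hagree _ _ u (hlt u) hu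
  exact (hα _ t (abs_lt.1 (hlt t))).congr_of_eventuallyEq hev

/-- The projection of `ℂ` onto the square `[-R, R]²`. -/
noncomputable def clamp (R : ℝ) (z : ℂ) : ℂ := ⟨max (-R) (min R z.re), max (-R) (min R z.im)⟩

theorem clamp_eq_self {R : ℝ} {z : ℂ} (h : ‖z‖ ≤ R) : clamp R z = z := by
  have h1 := abs_le.1 ((Complex.abs_re_le_norm z).trans h)
  have h2 := abs_le.1 ((Complex.abs_im_le_norm z).trans h)
  apply Complex.ext
  · simp [clamp, h1.1, h1.2]
  · simp [clamp, h2.1, h2.2]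

theorem norm_clamp_le {R : ℝ} (hR : 0 ≤ R) (z : ℂ) : ‖clamp R z‖ ≤ 2 * R := by
  have h : ∀ x : ℝ, |max (-R) (min R x)| ≤ R := fun x =>
    abs_le.2 ⟨le_max_left _ _, max_le (by linarith) (min_le_left _ _)⟩
  refine (Complex.norm_le_abs_re_add_abs_im _).trans ?_
  linarith [h z.re, h z.im, show |(clamp R z).re| = |max (-R) (min R z.re)| from rfl,
    show |(clamp R z).im| = |max (-R) (min R z.im)| from rfl]

theorem lipschitzWith_clamp (R : ℝ) : LipschitzWith 2 (clamp R) := by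
  have h : ∀ x y : ℝ, |max (-R) (min R x) - max (-R) (min R y)| ≤ |x - y| := fun x y => by
    have h1 := abs_max_sub_max_le_max (-R) (min R x) (-R) (min R y)
    have h2 := abs_min_sub_min_le_max R x R y
    rw [sub_self, abs_zero, max_eq_right (a := (0 : ℝ)) (abs_nonneg _)] at h1 h2
    exact h1.trans h2
  refine LipschitzWith.of_dist_le_mul fun z w => ?_
  rw [dist_eq_norm, dist_eq_norm]
  refine (Complex.norm_le_abs_re_add_abs_im _).trans ?_
  have h1 := (h z.re w.re).trans (Complex.abs_re_le_norm (z - w))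
  have h2 := (h z.im w.im).trans (Complex.abs_im_le_norm (z - w))
  simp only [NNReal.coe_ofNat]
  linarith [show |(clamp R z - clamp R w).re| =
      |max (-R) (min R z.re) - max (-R) (min R w.re)| from rfl,
    show |(clamp R z - clamp R w).im| = |max (-R) (min R z.im) - max (-R) (min R w.im)| from rfl]

/-- Every point lies on a solution for all times. The field, truncated outside a large square, has
one; by conservation of the first integral it never leaves the region where the truncated field
and the original one agree. -/
theorem exists_isGlobalSolution {δ : ℝ} (hδ : 0 < δ) (z₀ : ℂ) :
    ∃ Z : ℝ → ℂ, Z 0 = z₀ ∧ IsGlobalSolution δ Z := by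
  obtain ⟨R, hR, hbound⟩ := exists_norm_le_of_firstIntegral_le hδ (firstIntegral δ z₀)
  set v : ℂ → ℂ := fun z => vectorField (fun r => r ^ δ) (clamp (R + 1) z) with hv
  have hmem : ∀ z, clamp (R + 1) z ∈ Metric.closedBall (0 : ℂ) (2 * (R + 1)) := fun z => by
    simpa using norm_clamp_le (by linarith) z
  have hlip := (lipschitzOnWith_vectorField hδ (R := 2 * (R + 1))).comp
    (lipschitzWith_clamp (R + 1)).lipschitzOnWith (s := univ) (fun z _ => hmem z)
  rw [lipschitzOnWith_univ] at hlip
  have hL : ∀ z, ‖v z‖ ≤ Real.toNNReal (2 * (R + 1) * (2 * (R + 1)) ^ δ + 1) := by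
    intro z
    have h1 : ‖clamp (R + 1) z‖ ≤ 2 * (R + 1) := norm_clamp_le (by linarith) z
    have h2 : 0 ≤ ‖clamp (R + 1) z‖ ^ δ := by positivity
    rw [Real.coe_toNNReal _ (by positivity)]
    refine (norm_sub_le _ _).trans ?_
    rw [norm_mul, norm_mul, norm_I, one_mul, Complex.norm_of_nonneg h2]
    gcongr
  obtain ⟨Z, hZ0, hZ⟩ := exists_forall_hasDerivAt_of_bounded hlip hL z₀
  have hc : Continuous Z := continuous_iff_continuousAt.2 fun t => (hZ t).continuousAt
  have heq : ∀ t, ‖Z t‖ ≤ R + 1 → HasDerivAt Z (vectorField (fun r => r ^ δ) (Z t)) t := by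
    intro t ht
    have := hZ t
    simpa [hv, clamp_eq_self ht] using this
  refine ⟨Z, hZ0, fun t => heq t ?_⟩
  have hE := firstIntegral_eq_of_eventually hδ hc (t₀ := 0) (fun t ht => by
    have h1 : ‖Z t‖ < R + 1 := by linarith [hbound (Z t) (by rw [ht, hZ0])]
    filter_upwards [(hc.norm.tendsto t).eventually_lt_const h1] with u hu
    exact heq u hu.le) t
  linarith [hbound (Z t) (by rw [hE, hZ0])]

theorem exists_flow_isGeneratedBy {δ : ℝ} (hδ : 0 < δ) :
    ∃ Φ : Flow ℝ ℂ, ∀ z, IsGlobalSolution δ fun t => Φ t z := by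
  choose γ h0 hγ using exists_isGlobalSolution hδ
  refine ⟨⟨fun t z => γ z t, ?_, ?_, h0⟩, hγ⟩
  · rw [continuous_iff_continuousAt]
    rintro ⟨t₀, z₀⟩
    -- Solutions starting near `z₀` stay in a common ball, where Grönwall's inequality applies.
    obtain ⟨M, hM⟩ := (isCompact_closedBall z₀ 1).exists_bound_of_continuousOn
      (continuous_firstIntegral hδ).continuousOn
    obtain ⟨R, hR, hbound⟩ := exists_norm_le_of_firstIntegral_le hδ M
    have hball : ∀ z ∈ Metric.closedBall z₀ 1, ∀ t, ‖γ z t‖ ≤ R := fun z hz t => by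
      refine hbound _ ?_
      rw [(hγ z).firstIntegral_eq hδ t 0, h0]
      exact (le_abs_self _).trans (hM z hz)
    set K : NNReal := Real.toNNReal ((1 + δ) * R ^ δ)
    have hnear : ∀ᶠ p : ℝ × ℂ in nhds (t₀, z₀), p.2 ∈ Metric.closedBall z₀ 1 :=
      continuous_snd.continuousAt.preimage_mem_nhds (Metric.closedBall_mem_nhds _ one_pos)
    have hlim : Filter.Tendsto (fun p : ℝ × ℂ => dist p.2 z₀ * Real.exp (K * |p.1|) +
        dist (γ z₀ p.1) (γ z₀ t₀)) (nhds (t₀, z₀)) (nhds 0) := by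
      have hc : Continuous fun p : ℝ × ℂ => dist p.2 z₀ * Real.exp (K * |p.1|) +
          dist (γ z₀ p.1) (γ z₀ t₀) := by
        have := (hγ z₀).continuous
        fun_prop
      simpa using hc.tendsto (t₀, z₀)
    rw [ContinuousAt, tendsto_iff_dist_tendsto_zero]
    refine squeeze_zero' (Filter.Eventually.of_forall fun _ => dist_nonneg) ?_ hlim
    filter_upwards [hnear] with p hp
    refine (dist_triangle _ (γ z₀ p.1) _).trans (add_le_add_left ?_ _)
    have := (hγ p.2).dist_le hδ (hγ z₀) (hball p.2 hp)
      (hball z₀ (Metric.mem_closedBall_self zero_le_one)) p.1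
    rwa [h0, h0] at this
  · intro t₁ t₂ x
    have := ((hγ x).comp_add_const t₂).unique hδ (hγ (γ x t₂)) (t₀ := 0) (by simp [h0]) t₁
    exact this

/-! ### One-variable calculus -/

theorem eventually_lt_right_of_hasDerivAt_neg {f : ℝ → ℝ} {f' a : ℝ} (h : HasDerivAt f f' a)
    (hf' : f' < 0) : ∀ᶠ t in nhdsWithin a (Ioi a), f t < f a := by
  have h1 := (hasDerivAt_iff_tendsto_slope.1 h).eventually_lt_const hf'
  have h2 : ∀ᶠ t in nhdsWithin a (Ioi a), slope f a t < 0 :=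
    h1.filter_mono (nhdsWithin_mono _ fun t (ht : a < t) => ht.ne')
  filter_upwards [h2, self_mem_nhdsWithin] with t ht hat
  rw [slope_def_field, div_lt_iff₀ (sub_pos.2 hat), zero_mul] at ht
  linarith

theorem eventually_lt_left_of_hasDerivAt_neg {f : ℝ → ℝ} {f' a : ℝ} (h : HasDerivAt f f' a)
    (hf' : f' < 0) : ∀ᶠ t in nhdsWithin a (Iio a), f a < f t := by
  have h1 := (hasDerivAt_iff_tendsto_slope.1 h).eventually_lt_const hf'
  have h2 : ∀ᶠ t in nhdsWithin a (Iio a), slope f a t < 0 :=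
    h1.filter_mono (nhdsWithin_mono _ fun t (ht : t < a) => ht.ne)
  filter_upwards [h2, self_mem_nhdsWithin] with t ht hat
  have hat' : t - a < 0 := sub_neg.2 hat
  rw [slope_def_field, div_lt_iff_of_neg hat', zero_mul] at ht
  linarith

/-- A continuous function which is positive to the right of `a` and nonpositive at `b` has a first
zero after `a`. -/
theorem exists_first_zero {f : ℝ → ℝ} (hf : Continuous f) {a b : ℝ} (hab : a < b)
    (ha : ∀ᶠ t in nhdsWithin a (Ioi a), 0 < f t) (hb : f b ≤ 0) :
    ∃ c ∈ Ioc a b, f c = 0 ∧ ∀ t ∈ Ioo a c, 0 < f t := by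
  obtain ⟨a', ha', hpos⟩ := mem_nhdsGT_iff_exists_Ioo_subset.1 ha
  rw [mem_Ioi] at ha'
  have ha'b : a' ≤ b := by
    by_contra! h
    exact absurd (hpos ⟨hab, h⟩) (not_lt.2 hb)
  set m := (a + a') / 2 with hm
  have hm1 : a < m := by rw [hm]; linarith
  have hm2 : m < a' := by rw [hm]; linarith
  set S := {t | t ∈ Icc m b ∧ f t ≤ 0} with hS
  have hSc : IsCompact S :=
    isCompact_Icc.inter_right (isClosed_le hf continuous_const)
  obtain ⟨c, ⟨⟨hc1, hc2⟩, hc3⟩, hmin⟩ := hSc.exists_isLeast ⟨b, ⟨by linarith, le_rfl⟩, hb⟩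
  have hpos' : ∀ t ∈ Ioo a c, 0 < f t := by
    intro t ht
    by_cases h : t < a'
    · exact hpos ⟨ht.1, h⟩
    · by_contra! h0
      exact absurd (hmin ⟨⟨by linarith, by linarith [ht.2]⟩, h0⟩) (not_le.2 ht.2)
  have hac : a < c := by linarith
  refine ⟨c, ⟨hac, hc2⟩, le_antisymm hc3 ?_, hpos'⟩
  refine ge_of_tendsto (hf.continuousWithinAt (s := Iio c) (x := c)) ?_
  filter_upwards [Ioo_mem_nhdsLT hac] with t ht
  exact (hpos' t ht).le

/-! ### The curve traced in the fixed frame -/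

/-- `Z` is a solution avoiding the origin, and `θ` the angle by which the tangent of the curve with
moving-frame coordinate `Z` has turned since time `0`. -/
structure IsFrame (δ : ℝ) (Z : ℝ → ℂ) (θ : ℝ → ℝ) : Prop where
  sol : IsGlobalSolution δ Z
  ne_zero : ∀ t, Z t ≠ 0
  angle_zero : θ 0 = 0
  deriv_angle : ∀ t, HasDerivAt θ (‖Z t‖ ^ δ) t

/-- The curve `conj Z · exp (i θ)`, whose curvature at distance `r` from the origin is `r ^ δ` when
`Z` and `θ` form a frame. -/
noncomputable def develop (Z : ℝ → ℂ) (θ : ℝ → ℝ) (t : ℝ) : ℂ := conj (Z t) * exp (I * θ t)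

theorem norm_exp_I_mul (x : ℝ) : ‖exp (I * x)‖ = 1 := by
  rw [mul_comm]; exact norm_exp_ofReal_mul_I x

theorem conj_exp_I_mul_mul_self (x : ℝ) : conj (exp (I * x)) * exp (I * x) = 1 := by
  rw [← Complex.normSq_eq_conj_mul_self, Complex.normSq_eq_norm_sq, norm_exp_I_mul]; simp

theorem norm_develop (Z : ℝ → ℂ) (θ : ℝ → ℝ) (t : ℝ) : ‖develop Z θ t‖ = ‖Z t‖ := by
  simp [develop]

theorem exp_I_mul_re (x : ℝ) : (exp (I * x)).re = Real.cos x := by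
  rw [mul_comm]; exact exp_ofReal_mul_I_re x

theorem exp_I_mul_im (x : ℝ) : (exp (I * x)).im = Real.sin x := by
  rw [mul_comm]; exact exp_ofReal_mul_I_im x

theorem develop_im (Z : ℝ → ℂ) (θ : ℝ → ℝ) (t : ℝ) :
    (develop Z θ t).im = (Z t).re * Real.sin (θ t) - (Z t).im * Real.cos (θ t) := by
  rw [develop, mul_im, exp_I_mul_re, exp_I_mul_im, conj_re, conj_im]
  ring

theorem hasDerivAt_exp_I_mul {θ : ℝ → ℝ} {κ t : ℝ} (h : HasDerivAt θ κ t) :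
    HasDerivAt (fun u => exp (I * θ u)) (I * κ * exp (I * θ t)) t := by
  have := (h.ofReal_comp.const_mul I).cexp
  rw [mul_comm] at this
  exact this

namespace IsFrame

variable {δ : ℝ} {Z : ℝ → ℂ} {θ : ℝ → ℝ}

theorem hasDerivAt_develop (h : IsFrame δ Z θ) (t : ℝ) :
    HasDerivAt (develop Z θ) (I * exp (I * θ t)) t := by
  have h1 := (hasDerivAt_conj_of_hasDerivAt (h.sol t)).mul (hasDerivAt_exp_I_mul (h.deriv_angle t))
  refine h1.congr_deriv ?_
  simp [vectorField]
  ring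

theorem norm_pos (h : IsFrame δ Z θ) (t : ℝ) : 0 < ‖Z t‖ := norm_pos_iff.2 (h.ne_zero t)

theorem hasDerivAt_curvature (h : IsFrame δ Z θ) (t : ℝ) :
    HasDerivAt (fun u => ‖Z u‖ ^ δ) (-δ * (Z t).im * ‖Z t‖ ^ (δ - 2)) t :=
  hasDerivAt_norm_rpow δ (h.sol t) (Or.inl (h.ne_zero t))

theorem strictMono_angle (h : IsFrame δ Z θ) : StrictMono θ :=
  strictMono_of_hasDerivAt_pos h.deriv_angle fun t => Real.rpow_pos_of_pos (h.norm_pos t) δ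

theorem angle_pos (h : IsFrame δ Z θ) {t : ℝ} (ht : 0 < t) : 0 < θ t := by
  have := h.strictMono_angle ht
  rwa [h.angle_zero] at this

theorem continuous_angle (h : IsFrame δ Z θ) : Continuous θ :=
  continuous_iff_continuousAt.2 fun t => (h.deriv_angle t).continuousAt

theorem continuous_develop (h : IsFrame δ Z θ) : Continuous (develop Z θ) :=
  continuous_iff_continuousAt.2 fun t => (h.hasDerivAt_develop t).continuousAt

theorem hasDerivAt_im (h : IsFrame δ Z θ) (t : ℝ) :
    HasDerivAt (fun u => (Z u).im) ((Z t).re * ‖Z t‖ ^ δ - 1) t := by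
  have := hasDerivAt_im_of_hasDerivAt (h.sol t)
  rwa [vectorField_im] at this

/-- At a real point a solution is symmetric under reversal of time and complex conjugation. -/
theorem reflect (h : IsFrame δ Z θ) (hδ : 0 < δ) {a : ℝ} (ha : (Z a).im = 0) (t : ℝ) :
    Z (2 * a - t) = conj (Z t) := by
  have h1 := h.sol.unique hδ (h.sol.conj_comp_sub (2 * a)) (t₀ := a) (by
    have e : 2 * a - a = a := by ring
    rw [e, Complex.conj_eq_iff_im.2 ha]) t
  rw [h1, Complex.conj_conj]

theorem reflect_angle (h : IsFrame δ Z θ) (hδ : 0 < δ) {a : ℝ} (ha : (Z a).im = 0) (t : ℝ) :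
    θ (2 * a - t) = 2 * θ a - θ t := by
  have hd : ∀ u, HasDerivAt (fun u => θ (2 * a - u) + θ u) 0 u := fun u => by
    refine (((h.deriv_angle (2 * a - u)).comp_const_sub (2 * a) u).add
      (h.deriv_angle u)).congr_deriv ?_
    rw [h.reflect hδ ha, norm_conj, neg_add_cancel]
  have := is_const_of_deriv_eq_zero (fun u => (hd u).differentiableAt) (fun u => (hd u).deriv) t a
  have e : 2 * a - a = a := by ring
  simp only [e] at this
  linarith

theorem reflect_develop (h : IsFrame δ Z θ) (hδ : 0 < δ) {a : ℝ} (ha : (Z a).im = 0) (t : ℝ) :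
    develop Z θ (2 * a - t) = exp (I * θ a) ^ 2 * conj (develop Z θ t) := by
  rw [develop, develop, h.reflect hδ ha, h.reflect_angle hδ ha, map_mul, ← Complex.exp_conj,
    ← Complex.exp_nat_mul]
  have e : exp (I * ((2 * θ a - θ t : ℝ) : ℂ)) =
      exp ((2 : ℕ) * (I * θ a)) * exp (conj (I * (θ t : ℂ))) := by
    rw [← Complex.exp_add]
    congr 1
    simp
    ring
  rw [e]
  ring

theorem norm_le_norm (h : IsFrame δ Z θ) {a b : ℝ} (hab : a ≤ b)
    (hy : ∀ t ∈ Ioo a b, (Z t).im < 0) : ‖Z a‖ ≤ ‖Z b‖ := by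
  have hd := fun t => hasDerivAt_norm_sq_of_vectorField (h.sol t)
  have hm : MonotoneOn (fun t => ‖Z t‖ ^ 2) (Icc a b) := by
    refine monotoneOn_of_deriv_nonneg (convex_Icc a b)
      (fun t _ => (hd t).continuousAt.continuousWithinAt)
      (fun t _ => (hd t).differentiableAt.differentiableWithinAt) fun t ht => ?_
    rw [interior_Icc] at ht
    rw [(hd t).deriv]
    linarith [hy t ht]
  have := hm ⟨le_rfl, hab⟩ ⟨hab, le_rfl⟩ hab
  exact (pow_le_pow_iff_left₀ (norm_nonneg _) (norm_nonneg _) two_ne_zero).1 this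

/-- While the distance from the origin increases, the tangent turns by less than `π`. Indeed
`r^δ Im c + Re ċ` has derivative `(r^δ)˙ Im c`, hence is positive up to the first return of the
curve `c` to the real axis; but there it is `Re ċ = - sin θ`, so that `θ` exceeds `π`. At the time
with `θ = π`, however, `Im c` is already nonpositive. -/
theorem angle_lt_pi (h : IsFrame δ Z θ) (hδ : 0 < δ) {b : ℝ} (hb : 0 < b) (h0 : (Z 0).im = 0)
    (hy : ∀ t ∈ Ioo 0 b, (Z t).im < 0) : θ b < Real.pi := by
  by_contra! hpi
  obtain ⟨s, ⟨hs0, hsb⟩, hs⟩ : ∃ s ∈ Icc 0 b, θ s = Real.pi := by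
    have := intermediate_value_Icc hb.le h.continuous_angle.continuousOn
    exact this ⟨by rw [h.angle_zero]; exact Real.pi_pos.le, hpi⟩
  have hs0 : 0 < s := by
    refine lt_of_le_of_ne hs0 fun e => ?_
    rw [← e, h.angle_zero] at hs
    exact Real.pi_pos.ne hs
  have hys : (Z s).im ≤ 0 := by
    refine le_of_tendsto ((Complex.continuous_im.comp h.sol.continuous).continuousWithinAt
      (s := Iio s) (x := s)) ?_
    filter_upwards [Ioo_mem_nhdsLT hs0] with t ht
    exact (hy t ⟨ht.1, ht.2.trans_le hsb⟩).le
  have hC0 : (develop Z θ 0).im = 0 := by rw [develop_im, h.angle_zero, h0]; simp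
  have hdC := fun t => hasDerivAt_im_of_hasDerivAt (h.hasDerivAt_develop t)
  have hpos : ∀ᶠ t in nhdsWithin 0 (Ioi 0), 0 < (develop Z θ t).im := by
    have := eventually_lt_right_of_hasDerivAt_neg (hdC 0).neg (by
      rw [h.angle_zero]; simp)
    filter_upwards [this] with t ht
    simpa [hC0] using ht
  obtain ⟨c, ⟨hc0, hcs⟩, hc, hcpos⟩ := exists_first_zero
    (Complex.continuous_im.comp h.continuous_develop) hs0 hpos (by
      simp only [Function.comp, develop_im, hs]
      simpa using hys)
  simp only [Function.comp] at hc hcpos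
  have hG : ∀ t, HasDerivAt (fun u => ‖Z u‖ ^ δ * (develop Z θ u).im - Real.sin (θ u))
      (-δ * (Z t).im * ‖Z t‖ ^ (δ - 2) * (develop Z θ t).im) t := fun t => by
    refine (((h.hasDerivAt_curvature t).mul (hdC t)).sub (h.deriv_angle t).sin).congr_deriv ?_
    rw [mul_im, exp_I_mul_re, exp_I_mul_im, I_re, I_im]
    ring
  have hmono : StrictMonoOn (fun u => ‖Z u‖ ^ δ * (develop Z θ u).im - Real.sin (θ u))
      (Icc 0 c) := by
    refine strictMonoOn_of_deriv_pos (convex_Icc 0 c)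
      (fun t _ => (hG t).continuousAt.continuousWithinAt) fun t ht => ?_
    rw [interior_Icc] at ht
    rw [(hG t).deriv]
    have h1 := hy t ⟨ht.1, ht.2.trans_le (hcs.trans hsb)⟩
    have h2 : 0 < ‖Z t‖ ^ (δ - 2) := Real.rpow_pos_of_pos (h.norm_pos t) _
    have h3 := hcpos t ht
    have h4 : 0 < -δ * (Z t).im := by nlinarith
    positivity
  have hlt := hmono ⟨le_rfl, hc0.le⟩ ⟨hc0.le, le_rfl⟩ hc0
  simp only [hC0, h.angle_zero, Real.sin_zero, hc] at hlt
  have hsin : 0 ≤ Real.sin (θ c) :=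
    Real.sin_nonneg_of_nonneg_of_le_pi (h.angle_pos hc0).le
      ((h.strictMono_angle.monotone hcs).trans hs.le)
  linarith

/-- A solution starting at a real point `p < 1` meets the real axis again, at a point `q > 1`, and
in the meantime the tangent turns by less than `π`. -/
theorem exists_half_period (h : IsFrame δ Z θ) (hδ : 0 < δ) {p : ℝ} (hp : p < 1)
    (hZ0 : Z 0 = p) : ∃ τ q : ℝ, 0 < τ ∧ 1 < q ∧ Z τ = q ∧ (∀ t ∈ Ioo 0 τ, (Z t).im < 0) ∧
      0 < θ τ ∧ θ τ < Real.pi := by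
  have hlt : ∀ x : ℝ, x < 1 → x * |x| ^ δ < 1 := by
    intro x hx
    rcases le_or_gt x 0 with h0 | h0
    · have : 0 ≤ |x| ^ δ := by positivity
      nlinarith
    · have := Real.rpow_le_one (abs_nonneg x) (by rw [abs_of_pos h0]; exact hx.le) hδ.le
      nlinarith
  have h0 : (Z 0).im = 0 := by rw [hZ0, ofReal_im]
  have hneg := eventually_lt_right_of_hasDerivAt_neg (h.hasDerivAt_im 0) (by
    rw [hZ0, ofReal_re, norm_real, Real.norm_eq_abs]
    linarith [hlt p hp])
  rw [h0] at hneg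
  obtain ⟨b, hb, hyb⟩ : ∃ b, 0 < b ∧ 0 ≤ (Z b).im := by
    by_contra! hy
    -- The angular velocity would be bounded from below.
    have hθ : ∀ t, 0 < t → |p| ^ δ * t ≤ θ t := by
      intro t ht
      have := (convex_Icc 0 t).mul_sub_le_image_sub_of_le_deriv (f := θ) (C := |p| ^ δ)
        h.continuous_angle.continuousOn
        (fun u _ => (h.deriv_angle u).differentiableAt.differentiableWithinAt) (fun u hu => by
          rw [interior_Icc] at hu
          rw [(h.deriv_angle u).deriv]
          have := h.norm_le_norm hu.1.le fun v hv => hy v hv.1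
          rw [hZ0, norm_real, Real.norm_eq_abs] at this
          exact Real.rpow_le_rpow (abs_nonneg _) this hδ.le) 0 ⟨le_rfl, ht.le⟩ t ⟨ht.le, le_rfl⟩ ht.le
      simpa [h.angle_zero] using this
    have hp0 : 0 < |p| ^ δ := by
      have := h.norm_pos 0
      rw [hZ0, norm_real, Real.norm_eq_abs] at this
      exact Real.rpow_pos_of_pos this _
    have hT : 0 < Real.pi / |p| ^ δ := div_pos Real.pi_pos hp0
    have h1 := h.angle_lt_pi hδ hT h0 fun t ht => hy t ht.1
    have h2 := hθ _ hT
    rw [mul_div_cancel₀ _ hp0.ne'] at h2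
    linarith
  obtain ⟨τ, ⟨hτ, -⟩, hyτ, hpos⟩ := exists_first_zero (f := fun t => -(Z t).im)
    (Complex.continuous_im.comp h.sol.continuous).neg hb
    (by filter_upwards [hneg] with t ht using neg_pos.2 ht) (neg_nonpos.2 hyb)
  have hy : ∀ t ∈ Ioo 0 τ, (Z t).im < 0 := fun t ht => neg_pos.1 (hpos t ht)
  have hyτ : (Z τ).im = 0 := neg_eq_zero.1 hyτ
  have hZτ : Z τ = ((Z τ).re : ℂ) := Complex.ext rfl (by simpa using hyτ)
  refine ⟨τ, (Z τ).re, hτ, ?_, hZτ, hy, h.angle_pos hτ, h.angle_lt_pi hδ hτ h0 hy⟩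
  by_contra! hq
  rcases hq.lt_or_eq with hq | hq
  · have hd := eventually_lt_left_of_hasDerivAt_neg (h.hasDerivAt_im τ) (by
      rw [hZτ, norm_real, ofReal_re, Real.norm_eq_abs]
      linarith [hlt _ hq])
    rw [hyτ] at hd
    obtain ⟨t, ht1, ht2⟩ := (hd.and (Ioo_mem_nhdsLT hτ)).exists
    exact absurd (hy t ht2) (not_lt.2 ht1.le)
  · rw [hq] at hZτ
    have h1 := h.sol.firstIntegral_eq hδ 0 τ
    rw [hZτ] at h1
    have h2 := eq_one_of_firstIntegral_eq hδ (by simpa using h1)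
    rw [hZ0] at h2
    exact hp.ne (by exact_mod_cast h2)

end IsFrame

/-! ### The extreme distances from the origin -/

/-- The two points `a < 1 < b` at which `r^(δ+2)/(δ+2) - r` takes a given value have their midpoint
to the left of the minimum `1`, as the third derivative is positive. -/
theorem add_le_two_of_firstIntegral_eq {δ a b : ℝ} (hδ : 0 < δ) (ha : 0 < a) (ha1 : a < 1)
    (h : a ^ (δ + 2) / (δ + 2) - a = b ^ (δ + 2) / (δ + 2) - b) : a + b ≤ 2 := by
  by_contra! hab
  have hδ2 : 0 < δ + 2 := by linarith
  have hd : ∀ t : ℝ, HasDerivAt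
      (fun u : ℝ => ((1 + u) ^ (δ + 2) - (1 - u) ^ (δ + 2)) / (δ + 2) - 2 * u)
      ((1 + t) ^ (1 + δ) + (1 - t) ^ (1 + δ) - 2) t := by
    intro t
    have h1 := ((hasDerivAt_id t).const_add 1).rpow_const (p := δ + 2) (Or.inr (by linarith))
    have h2 := ((hasDerivAt_id t).const_sub 1).rpow_const (p := δ + 2) (Or.inr (by linarith))
    refine (((h1.sub h2).div_const (δ + 2)).sub ((hasDerivAt_id t).const_mul 2)).congr_deriv ?_
    have e : δ + 2 - 1 = 1 + δ := by ring
    simp only [e, id]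
    field_simp
    ring
  have hmono : MonotoneOn
      (fun u : ℝ => ((1 + u) ^ (δ + 2) - (1 - u) ^ (δ + 2)) / (δ + 2) - 2 * u) (Icc 0 1) := by
    refine monotoneOn_of_deriv_nonneg (convex_Icc 0 1)
      (fun t _ => (hd t).continuousAt.continuousWithinAt)
      (fun t _ => (hd t).differentiableAt.differentiableWithinAt) fun t ht => ?_
    rw [interior_Icc] at ht
    rw [(hd t).deriv]
    have h1 := rpow_tangent_le hδ zero_le_one (show 0 ≤ 1 + t by linarith [ht.1])
    have h2 := rpow_tangent_le hδ zero_le_one (show 0 ≤ 1 - t by linarith [ht.2])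
    simp only [Real.one_rpow] at h1 h2
    linarith
  have h1 := hmono ⟨le_rfl, zero_le_one⟩ (⟨by linarith, by linarith⟩ : 1 - a ∈ Icc (0 : ℝ) 1)
    (by linarith)
  simp only [add_zero, sub_zero, sub_self, zero_div, mul_zero, sub_sub_cancel, sub_div] at h1
  have h2 := rpow_tangent_le (δ := 1 + δ) (a := 1 + (1 - a)) (b := b) (by linarith) (by linarith)
    (by linarith)
  have e : (1 : ℝ) + (1 + δ) = δ + 2 := by ring
  rw [e] at h2
  have h3 : 1 < (1 + (1 - a)) ^ (1 + δ) := Real.one_lt_rpow (by linarith) (by linarith)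
  have h4 : (1 + (1 - a)) ^ (δ + 2) / (δ + 2) + (1 + (1 - a)) ^ (1 + δ) * (b - (1 + (1 - a))) ≤
      b ^ (δ + 2) / (δ + 2) := by
    rw [div_add' _ _ _ hδ2.ne']
    gcongr
    linarith
  nlinarith

theorem inv_cube_sub_le {p w : ℝ} (hp : 0 < p) (hw : 1 < w) (hpw : p < w)
    (h2 : p ^ 2 + w ^ 2 ≤ 2) (h1 : 1 ≤ p ^ 2 * w ^ 3) :
    (p ^ 3)⁻¹ - (w ^ 3)⁻¹ ≤ 12 / 5 * (w ^ 2 - p ^ 2) := by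
  have hw0 : 0 < w := by linarith
  have hw54 : w ≤ 5 / 4 := by
    by_contra! hc
    have hw2 : w ^ 2 < 2 := by nlinarith
    have h3 : 1 ≤ (2 - w ^ 2) * w ^ 3 := h1.trans (by gcongr; linarith)
    have hwlt : w < 3 / 2 := by nlinarith
    have h4 : (2 - w ^ 2) * w ^ 2 ≤ (2 - (5 / 4) ^ 2) * (5 / 4) ^ 2 := by
      nlinarith [mul_pos (sub_pos.2 hc) (sub_pos.2 hc)]
    have h5 : (2 - w ^ 2) * w ^ 3 = ((2 - w ^ 2) * w ^ 2) * w := by ring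
    have h6 : (2 - w ^ 2) * w ^ 2 * w ≤ (2 - (5 / 4) ^ 2) * (5 / 4) ^ 2 * w := by gcongr
    have h7 : w < 71 / 50 := by nlinarith
    norm_num at h6
    linarith
  set g := p * w with hg
  have hg0 : 0 < g := by positivity
  have hg1 : g ≤ 1 := by nlinarith [sq_nonneg (p - w)]
  have hg2 : 4 / 5 ≤ g ^ 2 := by
    have : 1 ≤ g ^ 2 * w := by rw [hg]; linarith [h1, show p ^ 2 * w ^ 3 = (p * w) ^ 2 * w by ring]
    nlinarith [sq_nonneg g]
  have hg89 : 89 / 100 ≤ g := by nlinarith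
  have hg3 : 71 / 100 ≤ g ^ 3 := by nlinarith
  have hs : 47 / 25 ≤ p + w := by nlinarith [sq_nonneg (p - w)]
  have hkey : p ^ 2 + g + w ^ 2 ≤ 12 / 5 * ((p + w) * g ^ 3) := by
    have : 47 / 25 * (71 / 100) ≤ (p + w) * g ^ 3 := by gcongr
    linarith
  have e : (p ^ 3)⁻¹ - (w ^ 3)⁻¹ = (w - p) * (p ^ 2 + g + w ^ 2) / g ^ 3 := by
    rw [hg]; field_simp; ring
  rw [e, div_le_iff₀ (by positivity)]
  calc (w - p) * (p ^ 2 + g + w ^ 2) ≤ (w - p) * (12 / 5 * ((p + w) * g ^ 3)) := by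
        gcongr
    _ = 12 / 5 * (w ^ 2 - p ^ 2) * g ^ 3 := by ring

/-- The centres of curvature at the extreme distances `a < 1 < b` are at the distances
`a ^ (-δ) - a` and `b - b ^ (-δ)` from the origin, and the arc of the evolute between them has
length `a ^ (-δ) - b ^ (-δ)`. By this inequality the angle they subtend at the origin is acute,
which is where `δ ≤ 3/2` enters. -/
theorem sq_rpow_sub_lt {δ a b : ℝ} (hδ' : δ ≤ 3 / 2) (ha : 0 < a) (ha1 : a < 1)
    (hb : 1 < b) (hab : a + b ≤ 2) (hδ : 0 < δ) :
    (a ^ (-δ) - b ^ (-δ)) ^ 2 < (a ^ (-δ) - a) ^ 2 + (b - b ^ (-δ)) ^ 2 := by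
  have hb0 : 0 < b := by linarith
  have hA : 1 < a ^ (-δ) := Real.one_lt_rpow_of_pos_of_lt_one_of_neg ha ha1 (by linarith)
  have hB : b ^ (-δ) < 1 := Real.rpow_lt_one_of_one_lt_of_neg hb (by linarith)
  rcases lt_or_ge a (b ^ (-δ)) with h | h
  · nlinarith [mul_pos (sub_pos.2 h) (sub_pos.2 (hB.trans hA)), sq_nonneg (b ^ (-δ) - a),
      mul_pos (sub_pos.2 (hB.trans hb)) (sub_pos.2 (hB.trans hb))]
  · have h1 : a ^ (-δ) ≤ a ^ (-(3 / 2) : ℝ) :=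
      Real.rpow_le_rpow_of_exponent_ge ha ha1.le (by linarith)
    have h2 : b ^ (-(3 / 2) : ℝ) ≤ b ^ (-δ) :=
      Real.rpow_le_rpow_of_exponent_le hb.le (by linarith)
    have e : ∀ x : ℝ, 0 < x → x ^ (-(3 / 2) : ℝ) = (√x ^ 3)⁻¹ := by
      intro x hx
      rw [Real.rpow_neg hx.le, Real.sqrt_eq_rpow, ← Real.rpow_natCast, ← Real.rpow_mul hx.le]
      norm_num
    rw [e a ha] at h1
    rw [e b hb0] at h2
    have hsa := Real.sq_sqrt ha.le
    have hsb := Real.sq_sqrt hb0.le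
    have hsb0 : 0 < √b := Real.sqrt_pos.2 hb0
    have h3 := inv_cube_sub_le (Real.sqrt_pos.2 ha) (Real.lt_sqrt_of_sq_lt (by simpa using hb))
      (Real.sqrt_lt_sqrt ha.le (ha1.trans hb)) (by rw [hsa, hsb]; exact hab) (by
        have h4 : (√b ^ 3)⁻¹ ≤ a := h2.trans h
        rw [hsa]
        rwa [inv_le_iff_one_le_mul₀ (by positivity)] at h4)
    rw [hsa, hsb] at h3
    have hd : a ^ (-δ) - b ^ (-δ) ≤ 12 / 5 * (b - a) := by linarith
    have hd0 : 0 < a ^ (-δ) - b ^ (-δ) := by linarith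
    nlinarith [sq_nonneg ((a ^ (-δ) - a) - (b - b ^ (-δ)))]

namespace IsFrame

variable {δ : ℝ} {Z : ℝ → ℂ} {θ : ℝ → ℝ}

/-- Over half a period of a solution which starts at `p ∈ (0, 1)` the tangent turns by more than
`π / 2`: the distance of the centres of curvature at both ends is at most the length of the arc of
the evolute between them. -/
theorem cos_angle_neg (h : IsFrame δ Z θ) (hδ : 0 < δ) (hδ' : δ ≤ 3 / 2) {p q τ : ℝ}
    (hp0 : 0 < p) (hp : p < 1) (hZ0 : Z 0 = p) (hτ : 0 < τ) (hq : 1 < q) (hZτ : Z τ = q)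
    (hy : ∀ t ∈ Ioo 0 τ, (Z t).im < 0) : Real.cos (θ τ) < 0 := by
  have hq0 : 0 < q := by linarith
  have hn0 : ‖Z 0‖ = p := by rw [hZ0, norm_real, Real.norm_of_nonneg hp0.le]
  have hnτ : ‖Z τ‖ = q := by rw [hZτ, norm_real, Real.norm_of_nonneg hq0.le]
  have hyIco : ∀ t ∈ Ico 0 τ, (Z t).im ≤ 0 := by
    intro t ht
    rcases ht.1.eq_or_lt with rfl | h0
    · rw [hZ0, ofReal_im]
    · exact (hy t ⟨h0, ht.2⟩).le
  have hρ := fun t => hasDerivAt_norm_rpow (-δ) (h.sol t) (Or.inl (h.ne_zero t))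
  set e : ℝ → ℂ := fun t => develop Z θ t - ((‖Z t‖ ^ (-δ) : ℝ) : ℂ) * exp (I * θ t) with he
  have hde : ∀ t, HasDerivAt e
      (-((- -δ * (Z t).im * ‖Z t‖ ^ (-δ - 2) : ℝ) : ℂ) * exp (I * θ t)) t := by
    intro t
    refine ((h.hasDerivAt_develop t).sub ((hρ t).ofReal_comp.mul
      (hasDerivAt_exp_I_mul (h.deriv_angle t)))).congr_deriv ?_
    have h1 : ((‖Z t‖ ^ (-δ) : ℝ) : ℂ) * ((‖Z t‖ ^ δ : ℝ) : ℂ) = 1 := by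
      rw [← ofReal_mul, ← Real.rpow_add (h.norm_pos t), neg_add_cancel, Real.rpow_zero, ofReal_one]
    linear_combination -I * exp (I * θ t) * h1
  have hle : ‖e τ - e 0‖ ≤ ‖Z 0‖ ^ (-δ) - ‖Z τ‖ ^ (-δ) := by
    refine image_norm_le_of_norm_deriv_right_le_deriv_boundary (f := fun t => e t - e 0)
      (B := fun t => ‖Z 0‖ ^ (-δ) - ‖Z t‖ ^ (-δ)) (a := 0) (b := τ)
      (fun t _ => ((hde t).sub_const _).continuousAt.continuousWithinAt)
      (fun t _ => ((hde t).sub_const _).hasDerivWithinAt) (by simp)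
      (fun t => (hρ t).const_sub _) (fun t ht => ?_) ⟨hτ.le, le_rfl⟩
    have h1 : 0 ≤ ‖Z t‖ ^ (-δ - 2) := by positivity
    have h2 : - -δ * (Z t).im * ‖Z t‖ ^ (-δ - 2) ≤ 0 := by
      have := hyIco t ht
      have h3 : - -δ * (Z t).im ≤ 0 := by nlinarith
      exact mul_nonpos_of_nonpos_of_nonneg h3 h1
    rw [norm_mul, norm_exp_I_mul, mul_one, norm_neg, norm_real, Real.norm_of_nonpos h2]
  have he0 : e 0 = ((p - p ^ (-δ) : ℝ) : ℂ) := by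
    simp [he, develop, h.angle_zero, hZ0, abs_of_pos hp0]
  have heτ : e τ = ((q - q ^ (-δ) : ℝ) : ℂ) * exp (I * θ τ) := by
    simp [he, develop, hZτ, abs_of_pos hq0]
    ring
  rw [hn0, hnτ] at hle
  have hE := h.sol.firstIntegral_eq hδ 0 τ
  rw [firstIntegral, firstIntegral, hn0, hnτ, hZ0, hZτ, ofReal_re, ofReal_re] at hE
  have hab := add_le_two_of_firstIntegral_eq hδ hp0 hp hE
  have hsq := sq_rpow_sub_lt hδ' hp0 hp hq hab hδ
  have hA : 1 < p ^ (-δ) := Real.one_lt_rpow_of_pos_of_lt_one_of_neg hp0 hp (by linarith)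
  have hB : q ^ (-δ) < 1 := Real.rpow_lt_one_of_one_lt_of_neg hq (by linarith)
  have hnorm : ‖e τ - e 0‖ ^ 2 = (q - q ^ (-δ)) ^ 2 + (p ^ (-δ) - p) ^ 2 +
      2 * (q - q ^ (-δ)) * (p ^ (-δ) - p) * Real.cos (θ τ) := by
    rw [← Complex.normSq_eq_norm_sq, Complex.normSq_apply, sub_re, sub_im, heτ, he0, re_ofReal_mul,
      im_ofReal_mul, ofReal_re, ofReal_im, exp_I_mul_re, exp_I_mul_im]
    linear_combination (q - q ^ (-δ)) ^ 2 * Real.sin_sq_add_cos_sq (θ τ)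
  have hle2 := pow_le_pow_left₀ (norm_nonneg _) hle 2
  rw [hnorm] at hle2
  have hpos : 0 < 2 * (q - q ^ (-δ)) * (p ^ (-δ) - p) := by
    have : 0 < q - q ^ (-δ) := by linarith
    have : 0 < p ^ (-δ) - p := by linarith
    positivity
  by_contra! hc
  nlinarith [mul_nonneg hpos.le hc]

end IsFrame

/-- Every solution avoiding the origin has a tangent angle. -/
theorem IsGlobalSolution.exists_isFrame {δ : ℝ} {Z : ℝ → ℂ} (hZ : IsGlobalSolution δ Z)
    (h0 : ∀ t, Z t ≠ 0) : ∃ θ, IsFrame δ Z θ := by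
  have hc : Continuous fun t => ‖Z t‖ ^ δ :=
    hZ.continuous.norm.rpow_const fun t => Or.inl (norm_ne_zero_iff.2 (h0 t))
  exact ⟨fun t => ∫ u in (0 : ℝ)..t, ‖Z u‖ ^ δ, hZ, h0, intervalIntegral.integral_same,
    fun t => intervalIntegral.integral_hasDerivAt_right (hc.intervalIntegrable _ _)
      (hc.stronglyMeasurableAtFilter _ _) hc.continuousAt⟩

theorem firstIntegral_zero {δ : ℝ} (hδ : 0 < δ) : firstIntegral δ 0 = 0 := by
  simp [firstIntegral, Real.zero_rpow (show δ + 2 ≠ 0 by linarith)]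

theorem firstIntegral_ofReal_ne_zero {δ p : ℝ} (hδ : 0 < δ) (hp : p < 1) (hp0 : p ≠ 0) :
    firstIntegral δ p ≠ 0 := by
  intro h
  have hδ2 : 0 < δ + 2 := by linarith
  have hpos : 0 < |p| ^ (δ + 2) := Real.rpow_pos_of_pos (abs_pos.2 hp0) _
  rw [firstIntegral, norm_real, Real.norm_eq_abs, ofReal_re, sub_eq_zero,
    div_eq_iff hδ2.ne'] at h
  have h0 : 0 < p := by
    by_contra! hc
    nlinarith
  rw [abs_of_pos h0] at h
  have : p ^ (δ + 2) ≤ p ^ (1 : ℝ) :=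
    Real.rpow_le_rpow_of_exponent_ge h0 hp.le (by linarith)
  rw [Real.rpow_one] at this
  nlinarith

/-! ### The net winding -/

namespace IsFrame

variable {δ : ℝ} {Z : ℝ → ℂ} {θ : ℝ → ℝ}

/-- The second half of a period is the mirror image of the first. -/
theorem apply_two_mul (h : IsFrame δ Z θ) (hδ : 0 < δ) {τ : ℝ} (h0 : (Z 0).im = 0)
    (hτ : (Z τ).im = 0) : Z (2 * τ) = Z 0 := by
  have := h.reflect hδ hτ 0
  rwa [sub_zero, Complex.conj_eq_iff_im.2 h0] at this

theorem sInf_period (h : IsFrame δ Z θ) (hδ : 0 < δ) {τ : ℝ} (h0 : (Z 0).im = 0)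
    (hτ0 : 0 < τ) (hτ : (Z τ).im = 0) (hne : Z τ ≠ Z 0) (hy : ∀ t ∈ Ioo 0 τ, (Z t).im < 0) :
    sInf {t : ℝ | 0 < t ∧ Z t = Z 0} = 2 * τ := by
  refine IsLeast.csInf_eq ⟨⟨by linarith, h.apply_two_mul hδ h0 hτ⟩, fun t ht => ?_⟩
  obtain ⟨ht0, ht⟩ := ht
  by_contra! hlt
  rcases lt_trichotomy t τ with h1 | rfl | h1
  · have := hy t ⟨ht0, h1⟩
    rw [ht, h0] at this
    exact lt_irrefl _ this
  · exact hne ht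
  · have h2 := hy (2 * τ - t) ⟨by linarith, by linarith⟩
    rw [h.reflect hδ hτ, ht, conj_im, h0] at h2
    simp at h2

/-- Up to the derivative of `x y`, the area element `x dy - y dx` of a solution is
`2 y² r^δ dt`. -/
theorem integral_area_pos (h : IsFrame δ Z θ) (hδ : 0 < δ) {τ : ℝ} (h0 : (Z 0).im = 0)
    (hτ0 : 0 < τ) (hτ : (Z τ).im = 0) (hy : ∀ t ∈ Ioo 0 τ, (Z t).im < 0) :
    0 < ∫ t in (0 : ℝ)..2 * τ, (conj (Z t) * deriv Z t).im := by
  have hcκ : Continuous fun t => ‖Z t‖ ^ δ :=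
    h.sol.continuous.norm.rpow_const fun t => Or.inl (h.norm_pos t).ne'
  have hcre : Continuous fun t => (Z t).re := Complex.continuous_re.comp h.sol.continuous
  have hcim : Continuous fun t => (Z t).im := Complex.continuous_im.comp h.sol.continuous
  have e : ∀ t, (conj (Z t) * deriv Z t).im =
      ((-(Z t).im * ‖Z t‖ ^ δ) * (Z t).im + (Z t).re * ((Z t).re * ‖Z t‖ ^ δ - 1)) +
        2 * (Z t).im ^ 2 * ‖Z t‖ ^ δ := by
    intro t
    rw [(h.sol t).deriv, mul_im, vectorField_re, vectorField_im, conj_re, conj_im]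
    ring
  have hd : ∀ t, HasDerivAt (fun u => (Z u).re * (Z u).im)
      ((-(Z t).im * ‖Z t‖ ^ δ) * (Z t).im + (Z t).re * ((Z t).re * ‖Z t‖ ^ δ - 1)) t := by
    intro t
    have h1 := hasDerivAt_re_of_hasDerivAt (h.sol t)
    rw [vectorField_re] at h1
    exact h1.mul (h.hasDerivAt_im t)
  simp only [e]
  rw [intervalIntegral.integral_add (Continuous.intervalIntegrable (by fun_prop) _ _)
      (Continuous.intervalIntegrable (by fun_prop) _ _),
    intervalIntegral.integral_eq_sub_of_hasDerivAt (fun t _ => hd t)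
      (Continuous.intervalIntegrable (by fun_prop) _ _), h.apply_two_mul hδ h0 hτ, sub_self,
    zero_add]
  refine intervalIntegral.integral_pos (by linarith) (by fun_prop) (fun t _ => by positivity)
    ⟨τ / 2, ⟨by linarith, by linarith⟩, ?_⟩
  have h1 := hy (τ / 2) ⟨by linarith, by linarith⟩
  have h2 : 0 < (Z (τ / 2)).im ^ 2 := sq_pos_of_neg h1
  have h3 := Real.rpow_pos_of_pos (h.norm_pos (τ / 2)) δ
  positivity

end IsFrame

/-- A trajectory of a generated flow on a level other than that of the origin is a solution for
all times. -/
theorem IsGeneratedBy.isGlobalSolution {δ : ℝ} (hδ : 0 < δ) {Φ : Flow ℝ ℂ}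
    (hΦ : IsGeneratedBy (fun r : ℝ => r ^ δ) Φ) {z : ℂ} (hz : firstIntegral δ z ≠ 0) :
    IsGlobalSolution δ (fun t => Φ t z) ∧ ∀ t, Φ t z ≠ 0 := by
  have hc : Continuous fun t => Φ t z := Φ.continuous continuous_id continuous_const
  have hE := firstIntegral_eq_of_eventually hδ hc (t₀ := 0) fun t ht => by
    have hne : Φ t z ≠ 0 := by
      intro h0
      rw [h0, firstIntegral_zero hδ, Φ.map_zero_apply] at ht
      exact hz ht.symm
    filter_upwards [hc.continuousAt.eventually_ne hne] with u hu
    exact hΦ z u hu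
  have hne : ∀ t, Φ t z ≠ 0 := fun t h0 => by
    have := hE t
    rw [h0, firstIntegral_zero hδ, Φ.map_zero_apply] at this
    exact hz this.symm
  exact ⟨fun t => hΦ z t (hne t), hne⟩

theorem netWinding_bounds {δ : ℝ} (hδ : 0 < δ) (hδ' : δ ≤ 3 / 2) {Φ : Flow ℝ ℂ}
    (hΦ : IsGeneratedBy (fun r : ℝ => r ^ δ) Φ) {s : ℝ} (hs0 : 0 < s) (hs1 : s < 1) :
    (s : ℂ) ∈ Per Φ ∧ (s : ℂ) ∉ Φ.orbit 0 ∧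
      1 / 2 < netWinding (fun r : ℝ => r ^ δ) Φ (s : ℂ) ∧
      netWinding (fun r : ℝ => r ^ δ) Φ (s : ℂ) < 1 := by
  obtain ⟨hsol, hne⟩ := hΦ.isGlobalSolution hδ (firstIntegral_ofReal_ne_zero hδ hs1 hs0.ne')
  obtain ⟨θ, h⟩ := hsol.exists_isFrame hne
  have hZ0 : Φ 0 (s : ℂ) = (s : ℂ) := Φ.map_zero_apply _
  obtain ⟨τ, q, hτ, hq, hZτ, hy, hθ0, hθ1⟩ := h.exists_half_period hδ hs1 hZ0
  have h0 : (Φ 0 (s : ℂ)).im = 0 := by rw [hZ0, ofReal_im]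
  have hτim : (Φ τ (s : ℂ)).im = 0 := by rw [hZτ, ofReal_im]
  have hneq : Φ τ (s : ℂ) ≠ Φ 0 (s : ℂ) := by
    rw [hZ0, hZτ, Ne, ofReal_inj]
    linarith
  have hcos := h.cos_angle_neg hδ hδ' hs0 hs1 hZ0 hτ hq hZτ hy
  have hθ2 : Real.pi / 2 < θ τ := by
    by_contra! hc
    exact absurd (Real.cos_nonneg_of_mem_Icc ⟨by linarith, hc⟩) (not_le.2 hcos)
  have hT : minPeriod Φ s = 2 * τ := by
    have := h.sInf_period hδ h0 hτ hτim hneq hy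
    rwa [hZ0] at this
  have harea : 0 < signedArea Φ s := by
    rw [signedArea, hT]
    exact mul_pos (by norm_num) (h.integral_area_pos hδ h0 hτ hτim hy)
  have hint : ∫ t in (0 : ℝ)..2 * τ, ‖Φ t (s : ℂ)‖ ^ δ = 2 * θ τ := by
    have hcκ : Continuous fun t => ‖Φ t (s : ℂ)‖ ^ δ :=
      h.sol.continuous.norm.rpow_const fun t => Or.inl (h.norm_pos t).ne'
    rw [intervalIntegral.integral_eq_sub_of_hasDerivAt (fun t _ => h.deriv_angle t)
      (hcκ.intervalIntegrable _ _), h.angle_zero]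
    have := h.reflect_angle hδ hτim 0
    rw [sub_zero, h.angle_zero] at this
    linarith
  have hw : netWinding (fun r : ℝ => r ^ δ) Φ (s : ℂ) = θ τ / Real.pi := by
    rw [netWinding, hT, Real.sign_of_pos harea, hint]
    field_simp
  refine ⟨⟨2 * τ, by linarith, (h.apply_two_mul hδ h0 hτim).trans hZ0⟩, ?_, ?_, ?_⟩
  · rw [Flow.mem_orbit_iff]
    rintro ⟨t, ht⟩
    refine hne (-t) ?_
    rw [← ht, ← Φ.map_add, neg_add_cancel, Φ.map_zero_apply]
  · rw [hw, lt_div_iff₀ Real.pi_pos]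
    linarith
  · rw [hw, div_lt_one Real.pi_pos]
    exact hθ1

/-! ### Simple closed curves do not branch -/

/-- If a path in a set homeomorphic to the circle is injective near the time `t₁` and returns to
the point `c t₁` at the time `t₂`, then near `t₂` it runs in the arc traced near `t₁`: by the
intermediate value theorem this arc is a neighbourhood of the point in the circle. -/
theorem eventually_mem_arc {K : Set ℂ} (e : K ≃ₜ Circle) {c : ℝ → ℂ} (hc : Continuous c)
    (hK : ∀ t, c t ∈ K) {t₁ t₂ ε : ℝ} (hε : 0 < ε) (hinj : InjOn c (Icc (t₁ - ε) (t₁ + ε)))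
    (h : c t₂ = c t₁) : ∀ᶠ u in nhds t₂, ∃ v ∈ Icc (t₁ - ε) (t₁ + ε), c u = c v := by
  set g : ℝ → Circle := fun t => e ⟨c t, hK t⟩ / e ⟨c t₁, hK t₁⟩ with hg
  have hgc : Continuous g := by
    have : Continuous fun t => (⟨c t, hK t⟩ : K) := hc.subtype_mk hK
    exact (e.continuous.comp this).div' continuous_const
  have hg1 : g t₁ = 1 := div_self' _
  have hg2 : g t₂ = 1 := by simp only [hg, h, div_self']
  have hgcc : Continuous fun t => (g t : ℂ) := continuous_subtype_val.comp hgc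
  have hslit : ∀ᶠ t in nhds t₁, (g t : ℂ) ∈ slitPlane :=
    hgcc.continuousAt.eventually_mem (isOpen_slitPlane.mem_nhds (by rw [hg1]; simp))
  obtain ⟨η, hη, hball⟩ := Metric.eventually_nhds_iff_ball.1 hslit
  set A : ℝ → ℝ := fun t => arg (g t : ℂ) with hA
  have hAinj : ∀ u v, A u = A v → c u = c v := by
    intro u v huv
    have h1 : g u = g v := Circle.injective_arg huv
    have h2 := e.injective (div_left_injective h1)
    exact congrArg Subtype.val h2
  have hA1 : A t₁ = 0 := by simp [hA, hg1]
  have hA2 : A t₂ = 0 := by simp [hA, hg2]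
  set r := min ε (η / 2) with hr
  have hr0 : 0 < r := by positivity
  have hsub : Icc (t₁ - r) (t₁ + r) ⊆ Icc (t₁ - ε) (t₁ + ε) :=
    Icc_subset_Icc (by linarith [min_le_left ε (η / 2)]) (by linarith [min_le_left ε (η / 2)])
  have hAc : ContinuousOn A (Icc (t₁ - r) (t₁ + r)) := by
    intro t ht
    have hmem : (g t : ℂ) ∈ slitPlane := hball t (by
      rw [Real.ball_eq_Ioo]
      exact ⟨by linarith [ht.1, min_le_right ε (η / 2)], by linarith [ht.2, min_le_right ε (η / 2)]⟩)
    exact (ContinuousAt.comp (f := fun t => (g t : ℂ)) (continuousAt_arg hmem)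
      hgcc.continuousAt).continuousWithinAt
  have hAt₂ : ContinuousAt A t₂ :=
    ContinuousAt.comp (f := fun t => (g t : ℂ)) (continuousAt_arg (by rw [hg2]; simp))
      hgcc.continuousAt
  have hAI : InjOn A (Icc (t₁ - r) (t₁ + r)) := fun u hu v hv huv =>
    hinj (hsub hu) (hsub hv) (hAinj u v huv)
  have hl : t₁ - r ∈ Icc (t₁ - r) (t₁ + r) := ⟨le_rfl, by linarith⟩
  have hm : t₁ ∈ Icc (t₁ - r) (t₁ + r) := ⟨by linarith, by linarith⟩
  have hrr : t₁ + r ∈ Icc (t₁ - r) (t₁ + r) := ⟨by linarith, le_rfl⟩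
  have hle : t₁ - r ≤ t₁ + r := by linarith
  rw [ContinuousAt, hA2] at hAt₂
  rcases hAc.strictMonoOn_of_injOn_Icc' hle hAI with hmono | hanti
  · have h1 : A (t₁ - r) < 0 := hA1 ▸ hmono hl hm (by linarith)
    have h2 : 0 < A (t₁ + r) := hA1 ▸ hmono hm hrr (by linarith)
    filter_upwards [hAt₂.eventually (Icc_mem_nhds h1 h2)] with u hu
    obtain ⟨v, hv, hvu⟩ := intermediate_value_Icc hle hAc hu
    exact ⟨v, hsub hv, hAinj u v hvu.symm⟩
  · have h1 : 0 < A (t₁ - r) := hA1 ▸ hanti hl hm (by linarith)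
    have h2 : A (t₁ + r) < 0 := hA1 ▸ hanti hm hrr (by linarith)
    filter_upwards [hAt₂.eventually (Icc_mem_nhds h2 h1)] with u hu
    obtain ⟨v, hv, hvu⟩ := intermediate_value_Icc' hle hAc hu
    exact ⟨v, hsub hv, hAinj u v hvu.symm⟩

namespace IsFrame

variable {δ : ℝ} {Z : ℝ → ℂ} {θ : ℝ → ℝ}

theorem exists_injOn_norm (h : IsFrame δ Z θ) {t : ℝ} (ht : (Z t).im ≠ 0) :
    ∃ ε > 0, InjOn (fun u => ‖Z u‖) (Icc (t - ε) (t + ε)) := by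
  have hev := (Complex.continuous_im.comp h.sol.continuous).continuousAt.eventually_ne ht
  obtain ⟨η, hη, hball⟩ := Metric.eventually_nhds_iff_ball.1 hev
  rw [Real.ball_eq_Ioo] at hball
  have hd := fun t => hasDerivAt_norm_sq_of_vectorField (h.sol t)
  have key : ∀ u ∈ Icc (t - η / 2) (t + η / 2), ∀ v ∈ Icc (t - η / 2) (t + η / 2), u < v →
      ‖Z u‖ ≠ ‖Z v‖ := by
    intro u hu v hv huv heq
    obtain ⟨w, hw, hw0⟩ := exists_hasDerivAt_eq_zero huv
      (fun x _ => (hd x).continuousAt.continuousWithinAt) (by simp only [heq])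
      (fun x _ => hd x)
    have := hball w ⟨by linarith [hu.1, hw.1], by linarith [hv.2, hw.2]⟩
    simp only [Function.comp] at this
    exact this (by linarith)
  refine ⟨η / 2, by positivity, fun u hu v hv huv => ?_⟩
  rcases lt_trichotomy u v with h1 | h1 | h1
  · exact absurd huv (key u hu v hv h1)
  · exact h1
  · exact absurd huv.symm (key v hv u hu h1)

/-- A curve which is simple closed meets each of its axes of symmetry only at extrema of the
distance from the origin. Otherwise the curve and its mirror image would have to coincide near the
intersection, hence lie on the axis; but its curvature does not vanish. -/
theorem im_eq_zero_of_mem_axis (h : IsFrame δ Z θ) (hδ : 0 < δ)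
    (e : (develop Z θ '' univ : Set ℂ) ≃ₜ Circle) {a t : ℝ} (ha : (Z a).im = 0)
    (ht : develop Z θ (2 * a - t) = develop Z θ t) : (Z t).im = 0 := by
  by_contra hy
  obtain ⟨ε, hε, hinj⟩ := h.exists_injOn_norm hy
  have hinj' : InjOn (develop Z θ) (Icc (t - ε) (t + ε)) := fun u hu v hv huv =>
    hinj hu hv (by simpa only [norm_develop] using congrArg norm huv)
  have hev := eventually_mem_arc e h.continuous_develop (fun t => mem_image_of_mem _ (mem_univ t))
    hε hinj' ht
  have hlim : Filter.Tendsto (fun w : ℝ => 2 * a - w) (nhds t) (nhds (2 * a - t)) :=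
    (by fun_prop : Continuous fun w : ℝ => 2 * a - w).tendsto t
  have hsym : ∀ᶠ w in nhds t, develop Z θ (2 * a - w) = develop Z θ w := by
    filter_upwards [hlim.eventually hev, Icc_mem_nhds (show t - ε < t by linarith)
      (show t < t + ε by linarith)] with w ⟨v, hv, hwv⟩ hw
    have h1 := congrArg norm hwv
    rw [norm_develop, norm_develop, h.reflect hδ ha, norm_conj] at h1
    rw [hwv, hinj hw hv h1]
  have htan : ∀ᶠ w in nhds t, exp (I * θ (2 * a - w)) = -exp (I * θ w) := by
    filter_upwards [hsym.eventually_nhds] with w hw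
    have h1 := (h.hasDerivAt_develop (2 * a - w)).comp_const_sub (2 * a) w
    have h2 := (h1.congr_of_eventuallyEq (hw.mono fun _ h => h.symm)).unique
      (h.hasDerivAt_develop w)
    have h3 : I * (exp (I * θ (2 * a - w)) + exp (I * θ w)) = 0 := by linear_combination -h2
    rcases mul_eq_zero.1 h3 with h4 | h4
    · exact absurd h4 I_ne_zero
    · exact eq_neg_of_add_eq_zero_left h4
  have h1 := (hasDerivAt_exp_I_mul (h.deriv_angle (2 * a - t))).comp_const_sub (2 * a) t
  have h2 := (h1.congr_of_eventuallyEq (htan.mono fun _ h => h.symm)).unique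
    (hasDerivAt_exp_I_mul (h.deriv_angle t)).neg
  rw [htan.self_of_nhds, h.reflect hδ ha, norm_conj] at h2
  have hκ : (((‖Z t‖ ^ δ : ℝ)) : ℂ) ≠ 0 :=
    ofReal_ne_zero.2 (Real.rpow_pos_of_pos (h.norm_pos t) δ).ne'
  have h3 : I * ((‖Z t‖ ^ δ : ℝ) : ℂ) * exp (I * θ t) * 2 = 0 := by linear_combination h2
  simp [I_ne_zero, hκ, exp_ne_zero] at h3

/-- The curve of a solution which starts at a real point `p < 1` is not simple closed. Let `Ψ` be
the angle by which the tangent turns over half a period. If `p < 0`, the half of the curve from its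
nearest to its farthest point crosses the axis of the farthest point, since `0 < Ψ < π`. If
`0 < p`, then `π / 2 < Ψ < π`, and the preceding half crosses that axis. -/
theorem not_nonempty_homeomorph_circle (h : IsFrame δ Z θ) (hδ : 0 < δ) (hδ' : δ ≤ 3 / 2)
    {p : ℝ} (hp : p < 1) (hZ0 : Z 0 = p) :
    ¬Nonempty ((develop Z θ '' univ : Set ℂ) ≃ₜ Circle) := by
  rintro ⟨e⟩
  obtain ⟨τ, q, hτ, hq, hZτ, hy, hθ0, hθ1⟩ := h.exists_half_period hδ hp hZ0
  have h0 : (Z 0).im = 0 := by rw [hZ0, ofReal_im]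
  have hτim : (Z τ).im = 0 := by rw [hZτ, ofReal_im]
  have hsin : 0 < Real.sin (θ τ) := Real.sin_pos_of_pos_of_lt_pi hθ0 hθ1
  have hp0 : p ≠ 0 := by
    have := h.ne_zero 0
    rwa [hZ0, Ne, ofReal_eq_zero] at this
  have hunit : conj (exp (I * θ τ)) * exp (I * θ τ) = 1 :=
    conj_exp_I_mul_mul_self (θ τ)
  -- The distance from the axis through the farthest point.
  set f : ℝ → ℝ := fun t => (conj (exp (I * θ τ)) * develop Z θ t).im with hf
  have hfc : Continuous f :=
    Complex.continuous_im.comp (continuous_const.mul h.continuous_develop)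
  have hzero : ∀ t, f t = 0 → (Z t).im = 0 := by
    intro t ht
    refine h.im_eq_zero_of_mem_axis hδ e hτim ?_
    have h1 := Complex.conj_eq_iff_im.2 ht
    rw [map_mul, Complex.conj_conj] at h1
    rw [h.reflect_develop hδ hτim]
    linear_combination exp (I * θ τ) * h1 + develop Z θ t * hunit
  have hf0 : f 0 = -p * Real.sin (θ τ) := by
    simp [hf, develop, hZ0, h.angle_zero, exp_I_mul_im, mul_im]
    ring
  rcases hp0.lt_or_gt with hneg | hpos
  · have hf0' : 0 < f 0 := by rw [hf0]; nlinarith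
    have hd := hasDerivAt_im_of_hasDerivAt
      ((h.hasDerivAt_develop τ).const_mul (conj (exp (I * θ τ))))
    have e1 : conj (exp (I * θ τ)) * (I * exp (I * θ τ)) = I := by linear_combination I * hunit
    rw [e1, I_im] at hd
    have hfτ : f τ = 0 := by
      simp only [hf, develop, hZτ, conj_ofReal]
      have e2 : conj (exp (I * θ τ)) * (q * exp (I * θ τ)) = q := by linear_combination q * hunit
      rw [e2, ofReal_im]
    have hev := eventually_lt_left_of_hasDerivAt_neg hd.neg (by norm_num)
    obtain ⟨t, ht1, ht2⟩ := (hev.and (Ioo_mem_nhdsLT hτ)).exists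
    have ht1 : f t < 0 := by
      have : -f τ < -f t := ht1
      linarith
    obtain ⟨s, hs, hs0⟩ := intermediate_value_Icc' ht2.1.le hfc.continuousOn ⟨ht1.le, hf0'.le⟩
    have hs1 : 0 < s := hs.1.lt_of_ne fun h => by rw [← h] at hs0; linarith
    have := hy s ⟨hs1, hs.2.trans_lt ht2.2⟩
    rw [hzero s hs0] at this
    exact lt_irrefl _ this
  · have hcos := h.cos_angle_neg hδ hδ' hpos hp hZ0 hτ hq hZτ hy
    have hf0' : f 0 < 0 := by rw [hf0]; nlinarith
    have hfτ : f (-τ) = -(2 * q * Real.sin (θ τ) * Real.cos (θ τ)) := by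
      have h1 := h.reflect hδ h0 τ
      have h2 := h.reflect_angle hδ h0 τ
      rw [mul_zero, zero_sub] at h1 h2
      rw [h.angle_zero, mul_zero, zero_sub] at h2
      simp only [hf, develop, h1, h2, hZτ]
      rw [Complex.conj_conj, mul_im, conj_re, conj_im, re_ofReal_mul, im_ofReal_mul,
        exp_I_mul_re, exp_I_mul_im, exp_I_mul_re, exp_I_mul_im, Real.cos_neg, Real.sin_neg]
      ring
    have hfτ' : 0 < f (-τ) := by
      rw [hfτ]
      have := mul_pos (mul_pos (show 0 < 2 * q by linarith) hsin) (neg_pos.2 hcos)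
      linarith
    obtain ⟨s, hs, hs0⟩ := intermediate_value_Icc' (by linarith : -τ ≤ 0) hfc.continuousOn
      ⟨hf0'.le, hfτ'.le⟩
    have hs1 : -τ < s := hs.1.lt_of_ne fun h => by rw [← h] at hs0; linarith
    have hs2 : s < 0 := hs.2.lt_of_ne fun h => by rw [h] at hs0; linarith
    have h1 := hy (-s) ⟨by linarith, by linarith⟩
    have h2 := h.reflect hδ h0 s
    rw [mul_zero, zero_sub] at h2
    rw [h2, conj_im, hzero s hs0] at h1
    simp at h1

end IsFrame

/-! ### Solutions avoid the origin -/

/-- A function with a zero at `t₀` which is a local minimum, and with a derivative that is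
differentiable at `t₀`, grows at most quadratically. -/
theorem exists_le_mul_sq_of_isLocalMin {f f' : ℝ → ℝ} {t₀ f'' : ℝ}
    (hf : ∀ᶠ t in nhds t₀, HasDerivAt f (f' t) t) (hf' : HasDerivAt f' f'' t₀) (h0 : f t₀ = 0)
    (hmin : IsLocalMin f t₀) : ∃ M : ℝ, 0 < M ∧ ∀ᶠ t in nhds t₀, f t ≤ M * (t - t₀) ^ 2 := by
  have hf0 : f' t₀ = 0 := hmin.hasDerivAt_eq_zero hf.self_of_nhds
  obtain ⟨M, hM, hbound⟩ := hf'.isBigO_sub.exists_pos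
  refine ⟨M, hM, ?_⟩
  obtain ⟨ε, hε, hball⟩ := Metric.eventually_nhds_iff_ball.1 (hf.and hbound.bound)
  filter_upwards [Metric.ball_mem_nhds t₀ hε] with t ht
  have hsub : Metric.closedBall t₀ |t - t₀| ⊆ Metric.ball t₀ ε :=
    Metric.closedBall_subset_ball (by simpa [Real.dist_eq] using ht)
  have h1 := (convex_closedBall t₀ |t - t₀|).norm_image_sub_le_of_norm_hasDerivWithin_le
    (f := f) (f' := f') (C := M * |t - t₀|) (x := t₀) (y := t)
    (fun u hu => (hball u (hsub hu)).1.hasDerivWithinAt) (fun u hu => by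
      have h2 := (hball u (hsub hu)).2
      rw [hf0, sub_zero] at h2
      refine h2.trans ?_
      rw [Metric.mem_closedBall, Real.dist_eq] at hu
      rw [Real.norm_eq_abs]
      gcongr)
    (Metric.mem_closedBall_self (abs_nonneg _)) (by simp [Real.dist_eq])
  rw [h0, sub_zero, Real.norm_eq_abs, Real.norm_eq_abs, mul_assoc, ← sq, sq_abs] at h1
  exact (le_abs_self _).trans h1

/-- A solution does not pass through the origin: near such a point its curvature would be
comparable to `|t - t₀| ^ δ`, while it is smooth with a minimum at `t₀`, and `δ < 2`. -/
theorem IsSolution.ne_zero {δ : ℝ} (hδ : 0 < δ) (hδ' : δ ≤ 3 / 2) {J : Set ℝ} {c : ℝ → ℂ}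
    (h : IsSolution (fun r : ℝ => r ^ δ) J c) {t₀ : ℝ} (ht₀ : t₀ ∈ J) : c t₀ ≠ 0 := by
  intro hc0
  obtain ⟨hc, θ, hθ, hκ⟩ := h
  have hJ := hc.isOpen.mem_nhds ht₀
  have hcd : HasDerivAt c (deriv c t₀) t₀ :=
    ((hc.smooth.differentiableOn (by simp)).differentiableAt hJ).hasDerivAt
  have hθ1 : ContDiffOn ℝ ∞ (deriv θ) J := hθ.smooth.deriv_of_isOpen hc.isOpen (by simp)
  have hθ2 : ContDiffOn ℝ ∞ (deriv (deriv θ)) J := hθ1.deriv_of_isOpen hc.isOpen (by simp)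
  have hd1 : ∀ t ∈ J, HasDerivAt (deriv θ) (deriv (deriv θ) t) t := fun t ht =>
    ((hθ1.differentiableOn (by simp)).differentiableAt (hc.isOpen.mem_nhds ht)).hasDerivAt
  have hd2 : HasDerivAt (deriv (deriv θ)) (deriv (deriv (deriv θ)) t₀) t₀ :=
    ((hθ2.differentiableOn (by simp)).differentiableAt hJ).hasDerivAt
  -- Near the origin the distance from it is at least half the arc length.
  have hlow : ∀ᶠ t in nhds t₀, |t - t₀| / 2 ≤ ‖c t‖ := by
    filter_upwards [(hasDerivAt_iff_isLittleO.1 hcd).def (show (0 : ℝ) < 1 / 2 by norm_num)]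
      with t ht
    rw [hc0, sub_zero, Real.norm_eq_abs] at ht
    have h1 := norm_sub_norm_le ((t - t₀) • deriv c t₀) (c t)
    rw [norm_smul, hc.unit_speed t₀ ht₀, mul_one, Real.norm_eq_abs, norm_sub_rev] at h1
    linarith
  have hκ' : ∀ᶠ t in nhdsWithin t₀ {t₀}ᶜ, deriv θ t = ‖c t‖ ^ δ := by
    filter_upwards [nhdsWithin_le_nhds hJ, nhdsWithin_le_nhds hlow, self_mem_nhdsWithin]
      with t htJ ht hne
    refine hκ t htJ (norm_pos_iff.1 ?_)
    have : 0 < |t - t₀| := abs_pos.2 (sub_ne_zero.2 hne)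
    linarith
  have hlim : Filter.Tendsto (deriv θ) (nhdsWithin t₀ {t₀}ᶜ) (nhds 0) := by
    have h1 : Filter.Tendsto (fun t => ‖c t‖ ^ δ) (nhds t₀) (nhds 0) := by
      have := hcd.continuousAt.norm.rpow_const (p := δ) (Or.inr hδ.le)
      simpa [ContinuousAt, hc0, Real.zero_rpow hδ.ne'] using this
    exact (h1.mono_left nhdsWithin_le_nhds).congr' (hκ'.mono fun _ h => h.symm)
  have hθ0 : deriv θ t₀ = 0 :=
    tendsto_nhds_unique ((hd1 t₀ ht₀).continuousAt.tendsto.mono_left nhdsWithin_le_nhds) hlim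
  have hmin : IsLocalMin (deriv θ) t₀ := by
    rw [eventually_nhdsWithin_iff] at hκ'
    filter_upwards [hκ'] with t ht
    rw [hθ0]
    by_cases hne : t = t₀
    · rw [hne, hθ0]
    · rw [ht hne]
      positivity
  obtain ⟨M, hM, hsq⟩ := exists_le_mul_sq_of_isLocalMin
    (hc.isOpen.eventually_mem ht₀ |>.mono hd1) hd2 hθ0 hmin
  have hev : ∀ᶠ t in nhdsWithin t₀ (Ioi t₀), (1 / 2 : ℝ) ^ δ ≤ M * (t - t₀) ^ (2 - δ) := by
    filter_upwards [hκ'.filter_mono (nhdsWithin_mono _ fun t (ht : t₀ < t) => ht.ne'),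
      nhdsWithin_le_nhds hsq, nhdsWithin_le_nhds hlow, self_mem_nhdsWithin] with t h1 h2 h3 h4
    have h5 : 0 < t - t₀ := sub_pos.2 h4
    rw [abs_of_pos h5] at h3
    have h6 : ((t - t₀) * (1 / 2)) ^ δ ≤ ‖c t‖ ^ δ :=
      Real.rpow_le_rpow (by positivity) (by linarith) hδ.le
    rw [Real.mul_rpow h5.le (by norm_num)] at h6
    have h7 : (t - t₀) ^ 2 = (t - t₀) ^ δ * (t - t₀) ^ (2 - δ) := by
      rw [← Real.rpow_add h5, ← Real.rpow_natCast]
      congr 1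
      push_cast
      ring
    rw [h1, h7] at h2
    have h8 := Real.rpow_pos_of_pos h5 δ
    refine le_of_mul_le_mul_left ?_ h8
    linarith
  have hlim2 : Filter.Tendsto (fun t : ℝ => M * (t - t₀) ^ (2 - δ)) (nhdsWithin t₀ (Ioi t₀))
      (nhds 0) := by
    have h1 : ContinuousAt (fun t : ℝ => M * (t - t₀) ^ (2 - δ)) t₀ :=
      continuousAt_const.mul ((continuousAt_id.sub continuousAt_const).rpow_const
        (Or.inr (by linarith)))
    have h2 := h1.tendsto
    simp only [sub_self, Real.zero_rpow (show 2 - δ ≠ 0 by linarith), mul_zero] at h2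
    exact h2.mono_left nhdsWithin_le_nhds
  have := ge_of_tendsto hlim2 hev
  have h9 : (0 : ℝ) < (1 / 2 : ℝ) ^ δ := by positivity
  linarith

/-! ### The moving frame of a solution -/

/-- The coordinate `-i conj(c) ċ` of the curve `c` with tangent angle `θ` relative to its moving
frame. It determines the position of the tangent line up to rotations about the origin. -/
noncomputable def movingCoord (c : ℝ → ℂ) (θ : ℝ → ℝ) (t : ℝ) : ℂ :=
  -I * conj (c t) * exp (I * θ t)

theorem norm_movingCoord (c : ℝ → ℂ) (θ : ℝ → ℝ) (t : ℝ) : ‖movingCoord c θ t‖ = ‖c t‖ := by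
  rw [movingCoord, norm_mul, norm_mul, norm_exp_I_mul, norm_neg, norm_I, norm_conj, mul_one,
    one_mul]

theorem eq_of_movingCoord (c : ℝ → ℂ) (θ : ℝ → ℝ) (t : ℝ) :
    c t = -I * conj (movingCoord c θ t) * exp (I * θ t) := by
  have h : conj (exp (I * θ t)) * exp (I * θ t) = 1 :=
    conj_exp_I_mul_mul_self (θ t)
  simp only [movingCoord, map_mul, map_neg, conj_I, Complex.conj_conj]
  linear_combination -c t * h + c t * conj (exp (I * θ t)) * exp (I * θ t) * I_sq

theorem IsSolution.exists_movingCoord {δ : ℝ} (hδ : 0 < δ) (hδ' : δ ≤ 3 / 2) {J : Set ℝ}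
    {c : ℝ → ℂ} (h : IsSolution (fun r : ℝ => r ^ δ) J c) : ∃ θ : ℝ → ℝ,
      (∀ t ∈ J, HasDerivAt θ (‖c t‖ ^ δ) t) ∧
      ∀ t ∈ J, HasDerivAt (movingCoord c θ)
        (vectorField (fun r => r ^ δ) (movingCoord c θ t)) t := by
  have hne := fun t ht => h.ne_zero hδ hδ' (t₀ := t) ht
  obtain ⟨hc, θ, hθ, hκ⟩ := h
  have hdθ : ∀ t ∈ J, HasDerivAt θ (‖c t‖ ^ δ) t := fun t ht => by
    have := ((hθ.smooth.differentiableOn (by simp)).differentiableAt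
      (hc.isOpen.mem_nhds ht)).hasDerivAt
    rwa [hκ t ht (hne t ht)] at this
  refine ⟨θ, hdθ, fun t ht => ?_⟩
  have hdc : HasDerivAt c (exp (I * θ t)) t := by
    have := ((hc.smooth.differentiableOn (by simp)).differentiableAt
      (hc.isOpen.mem_nhds ht)).hasDerivAt
    rwa [hθ.deriv_eq t ht] at this
  refine (((hasDerivAt_conj_of_hasDerivAt hdc).const_mul (-I)).mul
    (hasDerivAt_exp_I_mul (hdθ t ht))).congr_deriv ?_
  have e : conj (exp (I * θ t)) * exp (I * θ t) = 1 :=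
    conj_exp_I_mul_mul_self (θ t)
  simp only [vectorField, norm_movingCoord]
  rw [movingCoord]
  linear_combination -I * e

namespace IsFrame

variable {δ : ℝ} {Z : ℝ → ℂ} {θ : ℝ → ℝ}

theorem contDiff_curvature (h : IsFrame δ Z θ) {n : WithTop ℕ∞} (hZ : ContDiff ℝ n Z) :
    ContDiff ℝ n fun t => ‖Z t‖ ^ δ :=
  (hZ.norm ℝ h.ne_zero).rpow_const_of_ne fun t => (h.norm_pos t).ne'

theorem contDiff (h : IsFrame δ Z θ) : ContDiff ℝ ∞ Z := by
  rw [contDiff_infty]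
  intro n
  induction n with
  | zero => exact contDiff_zero.2 h.sol.continuous
  | succ n ih =>
    push_cast
    refine contDiff_succ_iff_deriv.2 ⟨fun t => (h.sol t).differentiableAt, by simp, ?_⟩
    have e : deriv Z = fun t => I * Z t * ((‖Z t‖ ^ δ : ℝ) : ℂ) - I :=
      funext fun t => (h.sol t).deriv
    rw [e]
    have h1 : ContDiff ℝ n fun t => ((‖Z t‖ ^ δ : ℝ) : ℂ) :=
      ofRealCLM.contDiff.comp (h.contDiff_curvature ih)
    exact ((contDiff_const.mul ih).mul h1).sub contDiff_const

theorem contDiff_angle (h : IsFrame δ Z θ) : ContDiff ℝ ∞ θ := by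
  refine contDiff_infty_iff_deriv.2 ⟨fun t => (h.deriv_angle t).differentiableAt, ?_⟩
  have e : deriv θ = fun t => ‖Z t‖ ^ δ := funext fun t => (h.deriv_angle t).deriv
  rw [e]
  exact h.contDiff_curvature h.contDiff

theorem contDiff_develop (h : IsFrame δ Z θ) : ContDiff ℝ ∞ (develop Z θ) := by
  have h1 : ContDiff ℝ ∞ fun t => conj (Z t) :=
    conjCLE.toContinuousLinearMap.contDiff.comp h.contDiff
  have h2 : ContDiff ℝ ∞ fun t => exp (I * θ t) :=
    (contDiff_const.mul (ofRealCLM.contDiff.comp h.contDiff_angle)).cexp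
  exact h1.mul h2

/-- The rotated curves of a frame are solutions. -/
theorem isSolution (h : IsFrame δ Z θ) (α : ℝ) :
    IsSolution (fun r : ℝ => r ^ δ) univ fun t => -I * exp (I * α) * develop Z θ t := by
  have hd : ∀ t, HasDerivAt (fun t => -I * exp (I * α) * develop Z θ t)
      (exp (I * ((α + θ t : ℝ) : ℂ))) t := fun t => by
    refine ((h.hasDerivAt_develop t).const_mul _).congr_deriv ?_
    rw [ofReal_add, mul_add, Complex.exp_add]
    linear_combination -exp (I * α) * exp (I * θ t) * I_sq
  refine ⟨⟨isOpen_univ, ordConnected_univ, mem_univ 0,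
    (contDiff_const.mul h.contDiff_develop).contDiffOn, fun t _ => ?_⟩, fun t => α + θ t,
    ⟨(contDiff_const.add h.contDiff_angle).contDiffOn, fun t _ => (hd t).deriv⟩, fun t _ _ => ?_⟩
  · rw [(hd t).deriv, norm_exp_I_mul]
  · rw [((h.deriv_angle t).const_add α).deriv, norm_mul, norm_mul, norm_exp_I_mul, norm_neg,
      norm_I, norm_develop, mul_one, one_mul]

end IsFrame

/-! ### Jordan solutions -/

theorem eqOn_of_hasDerivAt_eq {J : Set ℝ} (hJ : IsOpen J) (hJ' : J.OrdConnected) {f g f' : ℝ → ℝ}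
    (hf : ∀ t ∈ J, HasDerivAt f (f' t) t) (hg : ∀ t ∈ J, HasDerivAt g (f' t) t) {t₀ : ℝ}
    (ht₀ : t₀ ∈ J) (h : f t₀ = g t₀) : EqOn f g J := by
  intro t ht
  have hd : ∀ u ∈ J, HasDerivAt (fun u => f u - g u) 0 u := fun u hu => by
    exact ((hf u hu).sub (hg u hu)).congr_deriv (sub_self _)
  have := hJ.is_const_of_deriv_eq_zero hJ'.isPreconnected
    (fun u hu => (hd u hu).differentiableAt.differentiableWithinAt)
    (fun u hu => (hd u hu).deriv) ht ht₀
  linarith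

theorem firstIntegral_eqOn {δ : ℝ} (hδ : 0 < δ) {J : Set ℝ} (hJ : IsOpen J)
    (hJ' : J.OrdConnected) {z : ℝ → ℂ}
    (hz : ∀ t ∈ J, HasDerivAt z (vectorField (fun r => r ^ δ) (z t)) t) {s t : ℝ}
    (hs : s ∈ J) (ht : t ∈ J) : firstIntegral δ (z s) = firstIntegral δ (z t) :=
  hJ.is_const_of_deriv_eq_zero hJ'.isPreconnected
    (fun u hu => (hasDerivAt_firstIntegral hδ (hz u hu)).differentiableAt.differentiableWithinAt)
    (fun u hu => (hasDerivAt_firstIntegral hδ (hz u hu)).deriv) hs ht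

/-- A Jordan solution has no tangent line perpendicular to the radius with moving coordinate
`p < 1`: it would extend to a complete curve that is not simple closed. -/
theorem IsJordanSolution.one_le_re {δ : ℝ} (hδ : 0 < δ) (hδ' : δ ≤ 3 / 2) {J : Set ℝ}
    {c : ℝ → ℂ} (h : IsJordanSolution (fun r : ℝ => r ^ δ) J c) {θ : ℝ → ℝ}
    (hθ : ∀ t ∈ J, HasDerivAt θ (‖c t‖ ^ δ) t)
    (hz : ∀ t ∈ J, HasDerivAt (movingCoord c θ)
      (vectorField (fun r => r ^ δ) (movingCoord c θ t)) t)
    {t₀ : ℝ} (ht₀ : t₀ ∈ J) (him : (movingCoord c θ t₀).im = 0) :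
    1 ≤ (movingCoord c θ t₀).re := by
  obtain ⟨⟨hsol, hmax⟩, ⟨e⟩⟩ := h
  by_contra! hp
  set p := (movingCoord c θ t₀).re
  have hzp : movingCoord c θ t₀ = p := Complex.ext rfl (by simpa using him)
  have hp0 : p ≠ 0 := by
    intro h0
    have h1 := norm_movingCoord c θ t₀
    rw [hzp, h0, ofReal_zero, norm_zero] at h1
    exact hsol.ne_zero hδ hδ' ht₀ (norm_eq_zero.1 h1.symm)
  obtain ⟨Z, hZ0, hZ⟩ := exists_isGlobalSolution hδ (p : ℂ)
  have hZne : ∀ t, Z t ≠ 0 := fun t ht => by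
    have := hZ.firstIntegral_eq hδ 0 t
    rw [ht, hZ0, firstIntegral_zero hδ] at this
    exact firstIntegral_ofReal_ne_zero hδ hp hp0 this
  obtain ⟨ϑ, hfr⟩ := hZ.exists_isFrame hZne
  set u : ℂ := -I * exp (I * θ t₀) with hu
  have hu0 : u ≠ 0 := mul_ne_zero (neg_ne_zero.2 I_ne_zero) (exp_ne_zero _)
  have hzZ : EqOn (movingCoord c θ) (fun t => Z (t - t₀)) J :=
    eqOn_of_hasDerivAt hδ hsol.1.isOpen hsol.1.ordConnected hz
      (fun t _ => (hZ (t - t₀)).comp_sub_const t t₀) ht₀ (by simp [hzp, hZ0])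
  have hθϑ : EqOn θ (fun t => θ t₀ + ϑ (t - t₀)) J := by
    refine eqOn_of_hasDerivAt_eq hsol.1.isOpen hsol.1.ordConnected hθ (fun t ht => ?_) ht₀
      (by simp [hfr.angle_zero])
    have h1 := ((hfr.deriv_angle (t - t₀)).comp_sub_const t t₀).const_add (θ t₀)
    rwa [← norm_movingCoord c θ, hzZ ht]
  have hsub : c '' J ⊆ (fun t => u * develop Z ϑ t) '' univ := by
    rintro _ ⟨t, ht, rfl⟩
    refine ⟨t - t₀, mem_univ _, ?_⟩
    have h1 := eq_of_movingCoord c θ t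
    rw [hzZ ht, hθϑ ht, ofReal_add, mul_add, Complex.exp_add] at h1
    rw [h1]
    simp only [develop, hu]
    ring
  have heq := hmax univ _ (hfr.isSolution (θ t₀)) hsub
  have himg : (fun t => u * develop Z ϑ t) '' univ =
      Homeomorph.mulLeft₀ u hu0 '' (develop Z ϑ '' univ) := by
    rw [image_image]
    rfl
  refine hfr.not_nonempty_homeomorph_circle hδ hδ' hp hZ0 ⟨?_⟩
  exact ((Homeomorph.mulLeft₀ u hu0).image _).trans
    ((Homeomorph.setCongr (heq.trans himg)).symm.trans e)

theorem firstIntegral_ofReal_of_pos (δ : ℝ) {p : ℝ} (hp : 0 < p) :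
    firstIntegral δ p = p ^ (δ + 2) / (δ + 2) - p := by
  rw [firstIntegral, norm_real, Real.norm_of_nonneg hp.le, ofReal_re]

/-- The first integral is injective on the real half-line from the fixed point `1`. -/
theorem eq_of_firstIntegral_ofReal_eq {δ p q : ℝ} (hδ : 0 < δ) (hp : 1 ≤ p) (hpq : p ≤ q)
    (h : firstIntegral δ p = firstIntegral δ q) : p = q := by
  by_contra hne
  have hlt : p < q := hpq.lt_of_ne hne
  rw [firstIntegral_ofReal_of_pos δ (by linarith), firstIntegral_ofReal_of_pos δ (by linarith)] at h
  have h1 := one_add_mul_self_lt_rpow_one_add (s := q / p - 1) (p := δ + 2)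
    (by linarith [div_nonneg (by linarith : 0 ≤ q) (by linarith : 0 ≤ p)]) (by
      rw [sub_ne_zero, Ne, div_eq_one_iff_eq (by linarith)]
      exact fun h => hne h.symm) (by linarith)
  have e : 1 + (q / p - 1) = q / p := by ring
  rw [e, Real.div_rpow (by linarith) (by linarith), lt_div_iff₀ (by positivity)] at h1
  have h2 : 1 ≤ p ^ (1 + δ) := Real.one_le_rpow hp (by linarith)
  have h3 : p ^ (δ + 2) = p ^ (1 + δ) * p := by
    rw [← Real.rpow_add_one (by linarith)]
    congr 1
    ring
  have h4 : (1 + (δ + 2) * (q / p - 1)) * p ^ (δ + 2) =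
      p ^ (δ + 2) + (δ + 2) * (p ^ (1 + δ) * (q - p)) := by
    rw [h3]
    field_simp
  have h5 : q - p ≤ p ^ (1 + δ) * (q - p) := by nlinarith
  have hδ2 : 0 < δ + 2 := by linarith
  have h6 : q ^ (δ + 2) - p ^ (δ + 2) = (δ + 2) * (q - p) := by
    field_simp at h
    linarith
  nlinarith

/-- The moving coordinate of a Jordan solution is the fixed point `1`. At the points nearest to
and farthest from the origin it is real, hence at least `1`; being on the same level of the first
integral, the two values agree, so that the distance from the origin is constant. -/
theorem IsJordanSolution.movingCoord_eq_one {δ : ℝ} (hδ : 0 < δ) (hδ' : δ ≤ 3 / 2) {J : Set ℝ}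
    {c : ℝ → ℂ} (h : IsJordanSolution (fun r : ℝ => r ^ δ) J c) {θ : ℝ → ℝ}
    (hθ : ∀ t ∈ J, HasDerivAt θ (‖c t‖ ^ δ) t)
    (hz : ∀ t ∈ J, HasDerivAt (movingCoord c θ)
      (vectorField (fun r => r ^ δ) (movingCoord c θ t)) t) :
    ∀ t ∈ J, movingCoord c θ t = 1 := by
  have hone := fun t₀ ht₀ him => h.one_le_re hδ hδ' hθ hz (t₀ := t₀) ht₀ him
  obtain ⟨⟨hsol, -⟩, ⟨e⟩⟩ := h
  set z := movingCoord c θ with hzdef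
  have hJ := hsol.1.isOpen
  have hK : IsCompact (c '' J) := by
    have : CompactSpace (c '' J) := e.symm.compactSpace
    exact isCompact_iff_compactSpace.2 this
  have hKne : (c '' J).Nonempty := ⟨c 0, 0, hsol.1.zero_mem, rfl⟩
  obtain ⟨_, ⟨a, ha, rfl⟩, hmin⟩ := hK.exists_isMinOn hKne continuous_norm.continuousOn
  obtain ⟨_, ⟨b, hb, rfl⟩, hmax⟩ := hK.exists_isMaxOn hKne continuous_norm.continuousOn
  have hmin' : ∀ t ∈ J, ‖z a‖ ≤ ‖z t‖ := fun t ht => by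
    simp only [hzdef, norm_movingCoord]
    exact hmin (mem_image_of_mem c ht)
  have hmax' : ∀ t ∈ J, ‖z t‖ ≤ ‖z b‖ := fun t ht => by
    simp only [hzdef, norm_movingCoord]
    exact hmax (mem_image_of_mem c ht)
  have hd := fun t ht => hasDerivAt_norm_sq_of_vectorField (hz t ht)
  have hya : (z a).im = 0 := by
    have hloc : IsLocalMin (fun u => ‖z u‖ ^ 2) a := by
      filter_upwards [hJ.mem_nhds ha] with t ht
      exact pow_le_pow_left₀ (norm_nonneg _) (hmin' t ht) 2
    linarith [hloc.hasDerivAt_eq_zero (hd a ha)]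
  have hyb : (z b).im = 0 := by
    have hloc : IsLocalMax (fun u => ‖z u‖ ^ 2) b := by
      filter_upwards [hJ.mem_nhds hb] with t ht
      exact pow_le_pow_left₀ (norm_nonneg _) (hmax' t ht) 2
    linarith [hloc.hasDerivAt_eq_zero (hd b hb)]
  have hpa := hone a ha hya
  have hqb := hone b hb hyb
  have hza : z a = ((z a).re : ℂ) := Complex.ext rfl (by simpa using hya)
  have hzb : z b = ((z b).re : ℂ) := Complex.ext rfl (by simpa using hyb)
  have hna : ‖z a‖ = (z a).re := by
    rw [hza, norm_real, ofReal_re, Real.norm_of_nonneg (by linarith)]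
  have hnb : ‖z b‖ = (z b).re := by
    rw [hzb, norm_real, ofReal_re, Real.norm_of_nonneg (by linarith)]
  have hE := fun s hs t ht => firstIntegral_eqOn hδ hJ hsol.1.ordConnected hz (s := s) (t := t) hs ht
  have hpq : (z a).re = (z b).re := by
    refine eq_of_firstIntegral_ofReal_eq hδ hpa ?_ ?_
    · rw [← hna, ← hnb]
      exact hmin' b hb
    · rw [← hza, ← hzb]
      exact hE a ha b hb
  have hconst : ∀ t ∈ J, ‖z t‖ = (z a).re := fun t ht =>
    le_antisymm ((hmax' t ht).trans (by rw [hnb, hpq])) (hna ▸ hmin' t ht)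
  -- On a level, the distance from the origin determines the real part.
  have hza' : ∀ t ∈ J, z t = z a := by
    intro t ht
    have h1 := hE t ht a ha
    rw [firstIntegral, firstIntegral, hconst t ht, hna] at h1
    have h2 : (z t).re = (z a).re := by linarith
    have h3 := Complex.normSq_eq_norm_sq (z t)
    rw [Complex.normSq_apply, hconst t ht, h2] at h3
    have h4 : (z t).im = 0 := by nlinarith
    exact Complex.ext h2 (h4.trans hya.symm)
  have hv : vectorField (fun r => r ^ δ) (z a) = 0 := by
    refine (hz a ha).unique ((hasDerivAt_const a (z a)).congr_of_eventuallyEq ?_)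
    filter_upwards [hJ.mem_nhds ha] with t ht
    exact hza' t ht
  have h1 := congrArg Complex.im hv
  rw [vectorField_im, hna, zero_im] at h1
  have hre : (z a).re = 1 := by
    by_contra hne
    have hlt : 1 < (z a).re := hpa.lt_of_ne (Ne.symm hne)
    have := Real.one_lt_rpow hlt hδ
    nlinarith
  intro t ht
  rw [hza' t ht, hza, hre, ofReal_one]

theorem eq_exp_of_movingCoord_eq_one {δ : ℝ} {J : Set ℝ} {c : ℝ → ℂ} (hc : IsArcLengthPath J c)
    {θ : ℝ → ℝ} (hθ : ∀ t ∈ J, HasDerivAt θ (‖c t‖ ^ δ) t)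
    (h1 : ∀ t ∈ J, movingCoord c θ t = 1) :
    ∃ a : ℝ, ∀ t ∈ J, c t = exp (I * ((t + a : ℝ) : ℂ)) := by
  have hlin : EqOn θ (fun t => t + θ 0) J := by
    refine eqOn_of_hasDerivAt_eq hc.isOpen hc.ordConnected (f' := fun _ => 1) (fun t ht => ?_)
      (fun t _ => (hasDerivAt_id t).add_const _) hc.zero_mem (by simp)
    have := hθ t ht
    rwa [← norm_movingCoord c θ, h1 t ht, norm_one, Real.one_rpow] at this
  refine ⟨θ 0 - Real.pi / 2, fun t ht => ?_⟩
  rw [eq_of_movingCoord c θ t, h1 t ht, hlin ht, map_one, mul_one]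
  have e : I * ((t + (θ 0 - Real.pi / 2) : ℝ) : ℂ) =
      I * ((t + θ 0 : ℝ) : ℂ) + -(Real.pi / 2 * I) := by
    push_cast; ring
  rw [e, Complex.exp_add, Complex.exp_neg, Complex.exp_pi_div_two_mul_I, Complex.inv_I]
  ring

/-! ### The unit circle -/

theorem image_exp_I_mul_univ :
    (fun t : ℝ => exp (I * (t : ℂ))) '' univ = Metric.sphere (0 : ℂ) 1 := by
  ext z
  rw [mem_sphere_zero_iff_norm, image_univ, mem_range]
  constructor
  · rintro ⟨t, rfl⟩
    exact norm_exp_I_mul t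
  · intro hz
    refine ⟨arg z, ?_⟩
    have := norm_mul_exp_arg_mul_I z
    rw [hz, ofReal_one, one_mul] at this
    rw [mul_comm]
    exact this

theorem isSolution_exp_I_mul (δ : ℝ) :
    IsSolution (fun r : ℝ => r ^ δ) univ fun t : ℝ => exp (I * (t : ℂ)) := by
  have hd : ∀ t : ℝ, HasDerivAt (fun t : ℝ => exp (I * (t : ℂ)))
      (exp (I * ((t + Real.pi / 2 : ℝ) : ℂ))) t := fun t => by
    refine (hasDerivAt_exp_I_mul (hasDerivAt_id t)).congr_deriv ?_
    have e : I * ((t + Real.pi / 2 : ℝ) : ℂ) = I * (t : ℂ) + Real.pi / 2 * I := by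
      push_cast; ring
    rw [e, Complex.exp_add, Complex.exp_pi_div_two_mul_I]
    simp
    ring
  refine ⟨⟨isOpen_univ, ordConnected_univ, mem_univ 0, ?_, fun t _ => ?_⟩,
    fun t => t + Real.pi / 2, ⟨(contDiff_id.add contDiff_const).contDiffOn,
      fun t _ => (hd t).deriv⟩, fun t _ _ => ?_⟩
  · exact (contDiff_const.mul ofRealCLM.contDiff).cexp.contDiffOn
  · rw [(hd t).deriv, norm_exp_I_mul]
  · have h1 : HasDerivAt (fun t : ℝ => t + Real.pi / 2) 1 t := (hasDerivAt_id t).add_const _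
    rw [h1.deriv, norm_exp_I_mul]
    exact (Real.one_rpow δ).symm

theorem not_countable_sphere : ¬(Metric.sphere (0 : ℂ) 1).Countable := by
  intro h
  have hmaps : MapsTo (fun t : ℝ => exp (I * (t : ℂ))) (Ioo 0 1) (Metric.sphere (0 : ℂ) 1) :=
    fun t _ => mem_sphere_zero_iff_norm.2 (norm_exp_I_mul t)
  have hinj : InjOn (fun t : ℝ => exp (I * (t : ℂ))) (Ioo 0 1) := by
    intro s hs t ht hst
    have h1 := congrArg Complex.im hst
    simp only [exp_I_mul_im] at h1
    have hpi := Real.pi_gt_three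
    exact Real.injOn_sin ⟨by linarith [hs.1], by linarith [hs.2]⟩
      ⟨by linarith [ht.1], by linarith [ht.2]⟩ h1
  have := Cardinal.Real.Ioo_countable_iff.1 (hmaps.countable_of_injOn hinj h)
  linarith

theorem countable_of_forall_eventually_notMem {S : Set ℝ}
    (h : ∀ x ∈ S, ∀ᶠ t in nhdsWithin x {x}ᶜ, t ∉ S) : S.Countable := by
  have : DiscreteTopology S := by
    rw [discreteTopology_subtype_iff]
    intro x hx
    rw [Filter.inf_principal_eq_bot]
    exact h x hx
  exact Set.countable_coe_iff.1 (TopologicalSpace.separableSpace_iff_countable.1 inferInstance)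

/-- A solution that is not an arc of the unit circle meets it at most countably often, as the times
at which it does are isolated. -/
theorem countable_norm_eq_one {δ : ℝ} (hδ : 0 < δ) {J : Set ℝ} (hJ : IsOpen J)
    (hJ' : J.OrdConnected) {z : ℝ → ℂ}
    (hz : ∀ t ∈ J, HasDerivAt z (vectorField (fun r => r ^ δ) (z t)) t)
    (hne : ∀ t ∈ J, z t ≠ 1) : {t | t ∈ J ∧ ‖z t‖ = 1}.Countable := by
  refine countable_of_forall_eventually_notMem fun x hx => ?_
  obtain ⟨hxJ, hx1⟩ := hx
  have hE := fun t ht => firstIntegral_eqOn hδ hJ hJ' hz (s := t) (t := x) ht hxJ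
  have hre : ∀ t ∈ J, ‖z t‖ = 1 → (z t).re = (z x).re := by
    intro t ht h1
    have h2 := hE t ht
    rw [firstIntegral, firstIntegral, h1, hx1] at h2
    linarith
  by_cases hy : (z x).im = 0
  · have hx' : (z x).re = -1 := by
      have h3 := Complex.normSq_eq_norm_sq (z x)
      rw [Complex.normSq_apply, hx1, hy] at h3
      have h4 : ((z x).re - 1) * ((z x).re + 1) = 0 := by linarith
      rcases mul_eq_zero.1 h4 with h5 | h5
      · exact absurd (Complex.ext (by simp; linarith) (by simpa using hy)) (hne x hxJ)
      · linarith
    have hd := hasDerivAt_im_of_hasDerivAt (hz x hxJ)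
    rw [vectorField_im, hx', hx1, Real.one_rpow] at hd
    filter_upwards [hd.eventually_ne (c := 0) (by norm_num)] with t ht hmem
    have h3 := Complex.normSq_eq_norm_sq (z t)
    rw [Complex.normSq_apply, hmem.2, hre t hmem.1 hmem.2, hx'] at h3
    exact ht (by nlinarith)
  · have hd := hasDerivAt_re_of_hasDerivAt (hz x hxJ)
    rw [vectorField_re, hx1, Real.one_rpow, mul_one] at hd
    filter_upwards [hd.eventually_ne (c := (z x).re) (neg_ne_zero.2 hy)] with t ht hmem
    exact ht (hre t hmem.1 hmem.2)

theorem isJordanSolution_exp_I_mul {δ : ℝ} (hδ : 0 < δ) (hδ' : δ ≤ 3 / 2) :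
    IsJordanSolution (fun r : ℝ => r ^ δ) univ fun t : ℝ => exp (I * (t : ℂ)) := by
  refine ⟨⟨isSolution_exp_I_mul δ, fun J c hc hsub => ?_⟩, ?_⟩
  · obtain ⟨θ, hθ, hz⟩ := hc.exists_movingCoord hδ hδ'
    have hJ := hc.1.isOpen
    rw [image_exp_I_mul_univ] at hsub ⊢
    by_cases h1 : ∃ t₀ ∈ J, movingCoord c θ t₀ = 1
    · obtain ⟨t₀, ht₀, h1⟩ := h1
      refine hsub.antisymm ?_
      rintro _ ⟨t, ht, rfl⟩
      have h2 := firstIntegral_eqOn hδ hJ hc.1.ordConnected hz ht ht₀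
      rw [h1] at h2
      rw [mem_sphere_zero_iff_norm, ← norm_movingCoord c θ, eq_one_of_firstIntegral_eq hδ h2,
        norm_one]
    · push Not at h1
      have hcount := (countable_norm_eq_one hδ hJ hc.1.ordConnected hz h1).image c
      refine absurd (hcount.mono fun w hw => ?_) not_countable_sphere
      obtain ⟨t, ht, rfl⟩ := hsub hw
      exact ⟨t, ⟨ht, by rw [norm_movingCoord]; exact mem_sphere_zero_iff_norm.1 hw⟩, rfl⟩
  · refine ⟨(Homeomorph.setCongr image_exp_I_mul_univ).trans ?_⟩
    exact Homeomorph.setCongr (by ext; simp [Submonoid.unitSphere])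

theorem IsJordanSolution.eq_circle {δ : ℝ} (hδ : 0 < δ) (hδ' : δ ≤ 3 / 2) {J : Set ℝ}
    {c : ℝ → ℂ} (h : IsJordanSolution (fun r : ℝ => r ^ δ) J c) :
    c '' J = Metric.sphere (0 : ℂ) 1 ∧ ∃ a : ℝ, ∀ t ∈ J, c t = exp (I * ((t + a : ℝ) : ℂ)) := by
  obtain ⟨θ, hθ, hz⟩ := h.1.1.exists_movingCoord hδ hδ'
  obtain ⟨a, ha⟩ := eq_exp_of_movingCoord_eq_one h.1.1.1 hθ (h.movingCoord_eq_one hδ hδ' hθ hz)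
  refine ⟨?_, a, ha⟩
  rw [← image_exp_I_mul_univ]
  refine h.1.2 univ _ (isSolution_exp_I_mul δ) ?_
  rintro _ ⟨t, ht, rfl⟩
  exact ⟨t + a, mem_univ _, (ha t ht).symm⟩

end CurvatureFlow


theorem mainTheorem6 (δ : ℝ) (hδ : 0 < δ) (hδ' : δ ≤ 3 / 2) :
    (∃ Φ : Flow ℝ ℂ, CurvatureFlow.IsGeneratedBy (fun r : ℝ => r ^ δ) Φ) ∧
    (∀ Φ : Flow ℝ ℂ, CurvatureFlow.IsGeneratedBy (fun r : ℝ => r ^ δ) Φ →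
      ∀ s : ℝ, 0 < s → s < 1 →
        (s : ℂ) ∈ CurvatureFlow.Per Φ ∧ (s : ℂ) ∉ Φ.orbit 0 ∧
        1 / 2 < CurvatureFlow.netWinding (fun r : ℝ => r ^ δ) Φ (s : ℂ) ∧
        CurvatureFlow.netWinding (fun r : ℝ => r ^ δ) Φ (s : ℂ) < 1) ∧
    CurvatureFlow.IsJordanSolution (fun r : ℝ => r ^ δ) Set.univ
      (fun t : ℝ => Complex.exp (Complex.I * (t : ℂ))) ∧
    (∀ (J : Set ℝ) (c : ℝ → ℂ), CurvatureFlow.IsJordanSolution (fun r : ℝ => r ^ δ) J c →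
      c '' J = Metric.sphere (0 : ℂ) 1 ∧
      ∃ a : ℝ, ∀ t ∈ J, c t = Complex.exp (Complex.I * ((t + a : ℝ) : ℂ))) := by
  refine ⟨?_, fun Φ hΦ s hs0 hs1 => CurvatureFlow.netWinding_bounds hδ hδ' hΦ hs0 hs1,
    CurvatureFlow.isJordanSolution_exp_I_mul hδ hδ', fun J c hc => hc.eq_circle hδ hδ'⟩
  obtain ⟨Φ, hΦ⟩ := CurvatureFlow.exists_flow_isGeneratedBy hδ
  exact ⟨Φ, fun z t _ => hΦ z t⟩
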